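/- Let $n\in\mathbb{N}_0$ and $\hbar>0$. On the polynomials $\mathbb{C}[z,\bar z]$ in $z^1,\dots,z^n,\bar z^1,\dots,\bar z^n$ consider the Wick star product $$f\star g=\sum_{N\in\mathbb{N}_0^n}\frac{(2\hbar)^{|N|}}{N!}\,\frac{\partial^{|N|}f}{\partial z^N}\,\frac{\partial^{|N|}g}{\partial\bar z^N}$$ and the vector space basis of rescaled monomials, indexed by $(I,J)\in\mathbb{N}_0^n\times\mathbb{N}_0^n$, $$e_{I,J}=\frac{z^I\bar z^J}{I!\,J!\,(2\hbar)^{|I|+|J|}} .$$ Let $C^{\gamma}_{\alpha\beta}$ be the structure constants, $e_\alpha\star e_\beta=\sum_\gamma C^\gamma_{\alpha\beta}e_\gamma$. For $a=\sum_\gamma a_\gamma e_\gamma$, $m\in\mathbb{N}_0$, $0\le\ell<2^m$ and an index $\gamma$ define recursively $h_{0,0,\gamma}(a)=|a_\gamma|$, $$h_{m+1,2\ell,\gamma}(a)=\sum_\alpha h_{m,\ell,\alpha}(a)^2\sum_\beta|C^\gamma_{\alpha\beta}|,\qquad h_{m+1,2\ell+1,\gamma}(a)=\sum_\beta h_{m,\ell,\beta}(a)^2\sum_\alpha|C^\gamma_{\alpha\beta}|,$$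 and $\|a\|_{m,\ell,\gamma}=h_{m,\ell,\gamma}(a)^{1/2^m}\in[0,\infty]$. Then all $\|\cdot\|_{m,\ell,\gamma}$ are finite on $\mathbb{C}[z,\bar z]$ and are seminorms. Let $\mathcal{A}_{\mathrm{Wick}}$ be $(\mathbb{C}[z,\bar z],\star)$ with the locally convex topology they define. It has a completion, and every completion $\widehat{\mathcal{A}}_{\mathrm{Wick}}$ (a complete Hausdorff topological vector space in which $\mathcal{A}_{\mathrm{Wick}}$ is densely and topologically embedded) has the following properties. 1. $\widehat{\mathcal{A}}_{\mathrm{Wick}}$ is a Fréchet space, and $\star$ extends to a continuous bilinear associative product on it with unit $1$, i.e. $\widehat{\mathcal{A}}_{\mathrm{Wick}}$ is a Fréchet algebra. 2. It is strongly nuclear: for every continuous seminorm $p$ there are a continuous seminorm $q$, numbers $(\lambda_k)_{k\in\mathbb{N}}\in\bigcap_{r>0}\ell^r$, continuous linear functionals $f_k$ with $|f_k|\le q$ and vectors $y_k$ with $p(y_k)\le1$ such that $p\bigl(x-\sum_{k<M}\lambda_kf_k(x)y_k\bigr)\to0$ as $M\to\infty$ for all $x$. 3. The $e_{I,J}$ form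 an absolute Schauder basis: there are continuous linear functionals $c_{I,J}$ with $c_{I,J}(e_{K,L})=\delta_{IK}\delta_{JL}$ such that $x=\sum_{I,J}c_{I,J}(x)e_{I,J}$ converges unconditionally for all $x$, and for every continuous seminorm $p$ there is a continuous seminorm $q$ with $\sum_{I,J}|c_{I,J}(x)|\,p(e_{I,J})\le q(x)$ for all $x$. 4. For each $x\in\widehat{\mathcal{A}}_{\mathrm{Wick}}$ the series $\sum_{I,J}c_{I,J}(x)e_{I,J}(z)$ converges for every $z\in\mathbb{C}^n$ (with $\bar z$ the complex conjugate of $z$), and mapping $x$ to the resulting function on $\mathbb{C}^n$ is an injective linear map, which sends a polynomial to its polynomial function. Its image consists precisely of the real-analytic functions $F\colon\mathbb{C}^n\to\mathbb{C}$ whose Taylor coefficients $a_{I,J}$ at $0$, given by $F(z)=\sum_{I,J}a_{I,J}e_{I,J}(z)$ for $z$ near $0$, have sub-factorial growth with respect to $|I|+|J|$: for every $\epsilon>0$ there is a constant $C$ with $|a_{I,J}|\le C\,((|I|+|J|)!)^\epsilon$ for all $I,J$. 5. The map $x\mapsto(c_{I,J}(x))_{I,J}$ is an isomorphism of topological vector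 spaces from $\widehat{\mathcal{A}}_{\mathrm{Wick}}$ onto the Köthe space of sub-factorial growth $$\Lambda_{2n}=\Bigl\{(a_{I,J})_{I,J\in\mathbb{N}_0^n}\;\Big|\;p_\epsilon(a)=\sum_{I,J}\frac{|a_{I,J}|}{((|I|+|J|)!)^\epsilon}<\infty\ \text{for all }0<\epsilon<1\Bigr\}$$ with the topology of the seminorms $p_\epsilon$, $0<\epsilon<1$. -/

import Mathlib

open Filter Topology ENNReal

noncomputable section

/-! ### Seminorms on an algebra with a vector space basis -/

/-- The structure constants `C^γ_{αβ}` of a product `star` in the basis `b`: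
`b α ⋆ b β = ∑ γ, C^γ_{αβ} b γ`. -/
def structureConst {ι A : Type*} [AddCommGroup A] [Module ℂ A] (b : Module.Basis ι ℂ A)
    (star : A → A → A) (α β γ : ι) : ℂ :=
  b.repr (star (b α) (b β)) γ

/-- The quantities `h_{m,ℓ,γ}(a) ∈ [0,∞]` of a family of coefficients `a`:
`h_{0,ℓ,γ}(a) = |a_γ|`,
`h_{m+1,2ℓ,γ}(a) = ∑ α, h_{m,ℓ,α}(a)² ∑ β, |C^γ_{αβ}|`,
`h_{m+1,2ℓ+1,γ}(a) = ∑ β, h_{m,ℓ,β}(a)² ∑ α, |C^γ_{αβ}|`.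
Only the indices `ℓ < 2 ^ m` are relevant. Here `K α β γ` stands for `C^γ_{αβ}`. -/
def recH {ι : Type*} (K : ι → ι → ι → ℂ) (a : ι → ℂ) : ℕ → ℕ → ι → ℝ≥0∞
  | 0, _, γ => ‖a γ‖ₑ
  | m + 1, l, γ =>
      if Even l then ∑' α, recH K a m (l / 2) α ^ 2 * ∑' β, ‖K α β γ‖ₑ
      else ∑' β, recH K a m (l / 2) β ^ 2 * ∑' α, ‖K α β γ‖ₑ

/-- The extended seminorm `‖a‖_{m,ℓ,γ} = h_{m,ℓ,γ}(a) ^ (1 / 2 ^ m)` on the algebra. -/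
def recNorm {ι A : Type*} [AddCommGroup A] [Module ℂ A] (b : Module.Basis ι ℂ A)
    (star : A → A → A) (m l : ℕ) (γ : ι) (a : A) : ℝ≥0∞ :=
  recH (structureConst b star) (b.repr a) m l γ ^ ((1 : ℝ) / 2 ^ m)

/-- The topology of the seminorms `‖·‖_{m,ℓ,γ}`, `ℓ < 2 ^ m`: generated by all their open
balls. -/
@[reducible] def recTopology {ι A : Type*} [AddCommGroup A] [Module ℂ A] (b : Module.Basis ι ℂ A)
    (star : A → A → A) : TopologicalSpace A :=
  TopologicalSpace.generateFrom
    {U | ∃ (m l : ℕ) (γ : ι) (a₀ : A) (r : ℝ≥0∞), l < 2 ^ m ∧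
      U = {a | recNorm b star m l γ (a - a₀) < r}}

/-! ### The Weyl algebra with the Wick star product -/

/-- The index set of pairs `(I, J)` of multiindices in `ℕⁿ`, written as one multiindex on
`Fin n ⊕ Fin n`. The degree of `(I, J)` is `|I| + |J|`. -/
abbrev WickIndex (n : ℕ) : Type := Fin n ⊕ Fin n →₀ ℕ

/-- The vector space of polynomials `ℂ[z, z̄]`; the variable `Sum.inl k` is `z^k`, the variable
`Sum.inr k` is `z̄^k`. The parameter `ħ > 0` enters only in the product, the basis and the
topology. -/
def WickAlgebra (n : ℕ) {ħ : ℝ} (_ : 0 < ħ) : Type := MvPolynomial (Fin n ⊕ Fin n) ℂ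

instance {n : ℕ} {ħ : ℝ} (hħ : 0 < ħ) : AddCommGroup (WickAlgebra n hħ) :=
  inferInstanceAs (AddCommGroup (MvPolynomial (Fin n ⊕ Fin n) ℂ))

instance {n : ℕ} {ħ : ℝ} (hħ : 0 < ħ) : Module ℂ (WickAlgebra n hħ) :=
  inferInstanceAs (Module ℂ (MvPolynomial (Fin n ⊕ Fin n) ℂ))

/-- The iterated partial derivative `∂^{|N|} / ∂z^N` on `ℂ[z, z̄]`. -/
def derivZ {n : ℕ} (N : Fin n → ℕ) : Module.End ℂ (MvPolynomial (Fin n ⊕ Fin n) ℂ) :=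
  (List.ofFn fun k : Fin n =>
    ((MvPolynomial.pderiv (R := ℂ) (Sum.inl k : Fin n ⊕ Fin n)).toLinearMap :
      Module.End ℂ (MvPolynomial (Fin n ⊕ Fin n) ℂ)) ^ N k).prod

/-- The iterated partial derivative `∂^{|N|} / ∂z̄^N` on `ℂ[z, z̄]`. -/
def derivZBar {n : ℕ} (N : Fin n → ℕ) : Module.End ℂ (MvPolynomial (Fin n ⊕ Fin n) ℂ) :=
  (List.ofFn fun k : Fin n =>
    ((MvPolynomial.pderiv (R := ℂ) (Sum.inr k : Fin n ⊕ Fin n)).toLinearMap :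
      Module.End ℂ (MvPolynomial (Fin n ⊕ Fin n) ℂ)) ^ N k).prod

/-- The Wick star product
`f ⋆ g = ∑_N (2ħ)^{|N|} / N! (∂^{|N|} f / ∂z^N) (∂^{|N|} g / ∂z̄^N)` of polynomials in `ℂ[z, z̄]`;
only finitely many summands are nonzero. -/
def polyStar {n : ℕ} (ħ : ℝ) (f g : MvPolynomial (Fin n ⊕ Fin n) ℂ) :
    MvPolynomial (Fin n ⊕ Fin n) ℂ :=
  ∑ᶠ N : Fin n → ℕ,
    MvPolynomial.C (((2 * ħ : ℝ) : ℂ) ^ (∑ k, N k) / ((∏ k, (N k).factorial : ℕ) : ℂ)) *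
      (derivZ N f * derivZBar N g)

/-- The Wick star product as the product of the Weyl algebra. -/
def wickStar {n : ℕ} {ħ : ℝ} (hħ : 0 < ħ) (f g : WickAlgebra n hħ) : WickAlgebra n hħ :=
  polyStar ħ f g

/-- The scaling factor `1 / (I! J! (2ħ)^{|I| + |J|})`. -/
def wickScale (n : ℕ) (ħ : ℝ) (N : WickIndex n) : ℂ :=
  1 / (((∏ k, (N k).factorial : ℕ) : ℂ) * ((2 * ħ : ℝ) : ℂ) ^ N.degree)

theorem isUnit_wickScale (n : ℕ) {ħ : ℝ} (hħ : 0 < ħ) (N : WickIndex n) :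
    IsUnit (wickScale n ħ N) := by
  have h : ((2 * ħ : ℝ) : ℂ) ≠ 0 := by
    exact_mod_cast (by positivity : (2 * ħ : ℝ) ≠ 0)
  have h2 : ((∏ k, (N k).factorial : ℕ) : ℂ) ≠ 0 := by
    exact_mod_cast Finset.prod_ne_zero_iff.2 fun k _ => Nat.factorial_ne_zero (N k)
  exact isUnit_iff_ne_zero.2 (one_div_ne_zero (mul_ne_zero h2 (pow_ne_zero _ h)))

/-- The vector space basis of `ℂ[z, z̄]` of rescaled monomials
`e_{I,J} = z^I z̄^J / (I! J! (2ħ)^{|I| + |J|})`. -/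
def polyBasis (n : ℕ) {ħ : ℝ} (hħ : 0 < ħ) :
    Module.Basis (WickIndex n) ℂ (MvPolynomial (Fin n ⊕ Fin n) ℂ) :=
  Module.Basis.isUnitSMul (MvPolynomial.basisMonomials (Fin n ⊕ Fin n) ℂ)
    (isUnit_wickScale n hħ)

/-- The rescaled monomials `e_{I,J}` as a basis of the Weyl algebra. -/
def wickBasis (n : ℕ) {ħ : ℝ} (hħ : 0 < ħ) :
    Module.Basis (WickIndex n) ℂ (WickAlgebra n hħ) :=
  polyBasis n hħ

/-- The topology on the Weyl algebra given by all the seminorms `‖·‖_{m,ℓ,(I,J)}`. -/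
instance {n : ℕ} {ħ : ℝ} (hħ : 0 < ħ) : TopologicalSpace (WickAlgebra n hħ) :=
  recTopology (wickBasis n hħ) (wickStar hħ)

/-- The polynomial function on `ℂⁿ` of an element of `ℂ[z, z̄]`. -/
def WickAlgebra.eval {n : ℕ} {ħ : ℝ} {hħ : 0 < ħ} (f : WickAlgebra n hħ)
    (z : Fin n → ℂ) : ℂ :=
  MvPolynomial.eval (Sum.elim z fun k => starRingEnd ℂ (z k)) f

/-! ### Notions for locally convex spaces -/

/-- `j : A → E` is a completion of the topological vector space `A`: the space `E` is a complete
Hausdorff topological vector space, and `j` is linear with dense range and induces the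
topology of `A`. -/
structure IsTVSCompletion {A E : Type*} [AddCommGroup A] [Module ℂ A] [TopologicalSpace A]
    [AddCommGroup E] [Module ℂ E] [UniformSpace E] (j : A →ₗ[ℂ] E) : Prop where
  isUniformAddGroup : IsUniformAddGroup E
  continuousSMul : ContinuousSMul ℂ E
  completeSpace : CompleteSpace E
  t2Space : T2Space E
  isInducing : IsInducing j
  denseRange : DenseRange j

/-- A Fréchet space: complete, Hausdorff, with the topology given by countably many
seminorms. -/
structure IsFrechetSpace (E : Type*) [AddCommGroup E] [Module ℂ E] [UniformSpace E] :
    Prop where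
  isUniformAddGroup : IsUniformAddGroup E
  completeSpace : CompleteSpace E
  t2Space : T2Space E
  exists_seminorms : ∃ p : SeminormFamily ℂ E ℕ, WithSeminorms p

/-- A strongly nuclear space: for every continuous seminorm `p` there is a continuous seminorm
`q` such that the canonical map between the local Banach spaces `E_q → E_p` is
`x ↦ ∑ k, lam k • f k x • y k`, where `lam` is rapidly decreasing (`r`-summable for all
`r > 0`), the functionals `f k` are bounded by `q` and the vectors `y k` are bounded with
respect to `p`. -/
def IsStronglyNuclear (E : Type*) [AddCommGroup E] [Module ℂ E] [TopologicalSpace E] : Prop :=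
  ∀ p : Seminorm ℂ E, Continuous p → ∃ q : Seminorm ℂ E, Continuous q ∧
    ∃ (lam : ℕ → ℝ) (f : ℕ → E →L[ℂ] ℂ) (y : ℕ → E),
      (∀ r : ℝ, 0 < r → Summable fun k => |lam k| ^ r) ∧
      (∀ k x, ‖f k x‖ ≤ q x) ∧
      (∀ k, p (y k) ≤ 1) ∧
      ∀ x, Tendsto (fun M => p (x - ∑ k ∈ Finset.range M, ((lam k : ℂ) * f k x) • y k))
        atTop (𝓝 0)

open scoped Classical in
/-- The vectors `e` form an absolute Schauder basis of `E` with continuous coefficient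
functionals `c`: every `x` is the sum of the `c k x • e k`, and for every continuous seminorm
`p` the sum `∑ k, |c k x| p (e k)` converges and is bounded by a continuous seminorm of `x`. -/
structure IsAbsoluteSchauderBasis {ι E : Type*} [AddCommGroup E] [Module ℂ E]
    [TopologicalSpace E] (e : ι → E) (c : ι → E →L[ℂ] ℂ) : Prop where
  biorthogonal : ∀ k l, c k (e l) = if k = l then 1 else 0
  hasSum : ∀ x, HasSum (fun k => c k x • e k) x
  absolute : ∀ p : Seminorm ℂ E, Continuous p → ∃ q : Seminorm ℂ E, Continuous q ∧
    ∀ x, (Summable fun k => ‖c k x‖ * p (e k)) ∧ ∑' k, ‖c k x‖ * p (e k) ≤ q x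

/-! ### Sub-factorial growth -/

/-- Sub-factorial growth with respect to the degree of the multiindex: for all `ε > 0` there is
a constant `C` with `|a_N| ≤ C (|N|!) ^ ε`. -/
def HasSubfactorialGrowth {σ : Type*} (a : (σ →₀ ℕ) → ℂ) : Prop :=
  ∀ ε : ℝ, 0 < ε → ∃ C : ℝ, ∀ N, ‖a N‖ ≤ C * (N.degree.factorial : ℝ) ^ ε

/-- The families `(a_N)` with `p_ε(a) = ∑ N, |a_N| / (|N|!) ^ ε < ∞` for all `0 < ε < 1`. -/
def koetheSubmodule (σ : Type*) : Submodule ℂ ((σ →₀ ℕ) → ℂ) where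
  carrier := {a | ∀ ε ∈ Set.Ioo (0 : ℝ) 1,
    Summable fun N => ‖a N‖ / (N.degree.factorial : ℝ) ^ ε}
  zero_mem' := by
    intro ε _
    simp [summable_zero]
  add_mem' := by
    intro a b ha hb ε hε
    refine Summable.of_nonneg_of_le (fun N => by positivity) (fun N => ?_)
      ((ha ε hε).add (hb ε hε))
    rw [← add_div]
    exact div_le_div_of_nonneg_right (norm_add_le _ _) (by positivity)
  smul_mem' := by
    intro c a ha ε hε
    refine ((ha ε hε).mul_left ‖c‖).congr fun N => ?_
    simp [mul_div_assoc]

/-- The Köthe space of sub-factorial growth over the multiindices on `σ`. -/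
def KoetheSpace (σ : Type*) : Type _ := koetheSubmodule σ

instance (σ : Type*) : AddCommGroup (KoetheSpace σ) :=
  inferInstanceAs (AddCommGroup (koetheSubmodule σ))

instance (σ : Type*) : Module ℂ (KoetheSpace σ) :=
  inferInstanceAs (Module ℂ (koetheSubmodule σ))

/-- The coefficient `a_N` of an element of the Köthe space. -/
def KoetheSpace.coeff {σ : Type*} (a : KoetheSpace σ) (N : σ →₀ ℕ) : ℂ :=
  (show koetheSubmodule σ from a).1 N

/-- The seminorm `p_ε(a) = ∑ N, |a_N| / (|N|!) ^ ε`. -/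
def koetheSeminorm (σ : Type*) (ε : Set.Ioo (0 : ℝ) 1) : Seminorm ℂ (KoetheSpace σ) :=
  Seminorm.of (fun a => ∑' N, ‖a.coeff N‖ / (N.degree.factorial : ℝ) ^ (ε : ℝ))
    (by
      intro a b
      have ha := (show koetheSubmodule σ from a).2 ε ε.2
      have hb := (show koetheSubmodule σ from b).2 ε ε.2
      have hab := (show koetheSubmodule σ from a + b).2 ε ε.2
      refine (hab.tsum_le_tsum (fun N => ?_) (ha.add hb)).trans_eq (ha.tsum_add hb)
      rw [← add_div]
      exact div_le_div_of_nonneg_right (norm_add_le _ _) (by positivity))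
    (by
      intro c a
      rw [← tsum_mul_left]
      refine tsum_congr fun N => ?_
      rw [← mul_div_assoc, ← norm_mul]
      rfl)

instance : Nonempty (Set.Ioo (0 : ℝ) 1) := ⟨⟨1 / 2, by norm_num⟩⟩

/-- The topology of the Köthe space is given by the seminorms `p_ε`, `0 < ε < 1`. -/
instance (σ : Type*) : TopologicalSpace (KoetheSpace σ) :=
  SeminormFamily.moduleFilterBasis (𝕜 := ℂ) (koetheSeminorm σ) |>.topology

end

noncomputable section

/-! ### Factorials of degrees of multiindices -/

/-! The heart of the proof is that, in the coefficients with respect to the $e_{I,J}$, the recursive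
seminorms and the Köthe seminorms $p_\epsilon$ define the same topology. The structure constants are
explicit: they vanish unless $\alpha=(N,0)+\alpha'$, $\beta=(0,N)+\beta'$, $\gamma=\alpha'+\beta'$,
and then $C^\gamma_{\alpha\beta}$ is a product of binomials divided by $(2\hbar)^{|N|}N!$
(`exists_of_structureConst_ne_zero`, `structureConst_eq`).

Upper bound: the factor $1/N!$ can be traded for decay in $\alpha$ and $\beta$, giving
$|C^\gamma_{\alpha\beta}|\le
c^{|\alpha|+|\beta|+|\gamma|}(|\gamma|!)^{2\eta}/(|\alpha|!\,|\beta|!)^{\eta}$ for $0\le\eta\le1/2$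
(`exists_norm_structureConst_le`). Negative powers of $|N|!$ beat every exponential, so all sums in
the recursion converge, and induction on $m$ bounds $\|\cdot\|_{m,\ell,\gamma}$ by some $p_\epsilon$
(`exists_recH_le`). The same estimate makes $\star$ continuous.

Lower bound: the recursion can idle at an index $\alpha$ for $m$ steps by pairing with the unit; two
further steps then carry $\alpha$ to $0$ at total cost $D^3$ with $D=c^{|\alpha|}|\alpha|!$. The
root of order $2^{m+2}$ turns this into $D^{3/2^{m+2}}$, an arbitrarily small power of the factorial
(`enorm_pow_le_mul_recH`, `exists_koetheSeminorm_wickCoeff_le`).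

Hence the coefficient map embeds the algebra topologically and densely into the complete Köthe
space, and every completion is isomorphic to it (`IsTVSCompletion.exists_equiv`). The Fréchet
property, strong nuclearity and the basis are verified there; the product is extended by density.
Finally, coefficients of sub-factorial growth divided by $I!\,J!$ decay faster than any exponential,
so the elements are everywhere convergent power series in $z,\bar z$. Their coefficients are
determined because a polynomial in $z,\bar z$ vanishing on $\mathbb{C}^n$ is zero, and the identity
theorem describes the image. -/

theorem exists_pow_le_factorial_rpow {c δ : ℝ} (hc : 0 ≤ c) (hδ : 0 < δ) :
    ∃ C : ℝ, 0 < C ∧ ∀ k : ℕ, c ^ k ≤ C * (k.factorial : ℝ) ^ δ := by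
  -- The case δ = 1 is the classical `x ^ k / k! → 0`; it is applied to `c ^ (1 / δ)` and raised to
  -- the power δ.
  obtain ⟨B, hB⟩ := (FloorSemiring.tendsto_pow_div_factorial_atTop (c ^ (1 / δ))).bddAbove_range
  have hB' : ∀ k : ℕ, (c ^ (1 / δ)) ^ k ≤ (max B 1) * k.factorial := fun k => by
    have := hB ⟨k, rfl⟩
    rw [div_le_iff₀ (by positivity)] at this
    exact this.trans (by gcongr; exact le_max_left _ _)
  refine ⟨(max B 1) ^ δ, by positivity, fun k => ?_⟩
  rw [← Real.mul_rpow (by positivity) (by positivity)]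
  refine le_trans (le_of_eq ?_) (Real.rpow_le_rpow (by positivity) (hB' k) hδ.le)
  rw [← Real.rpow_natCast, ← Real.rpow_natCast, ← Real.rpow_mul hc, ← Real.rpow_mul hc]
  congr 1
  field_simp

/-- A finite set of multiindices lies in a box, and the sum over a box factors into finite geometric
sums. -/
theorem summable_pow_degree {σ : Type*} [Finite σ] {r : ℝ} (h0 : 0 ≤ r) (h1 : r < 1) :
    Summable fun N : σ →₀ ℕ => r ^ N.degree := by
  classical
  have := Fintype.ofFinite σ
  refine summable_of_sum_le (c := ∏ _i : σ, (1 - r)⁻¹) (fun N => by positivity) fun s => ?_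
  let M : ℕ := s.sup fun N => N.degree
  calc ∑ N ∈ s, r ^ N.degree
      = ∑ x ∈ s.image (fun N : σ →₀ ℕ => (N : σ → ℕ)), ∏ i, r ^ x i := by
        rw [Finset.sum_image fun _ _ _ _ h => DFunLike.coe_injective h]
        refine Finset.sum_congr rfl fun N _ => ?_
        rw [Finset.prod_pow_eq_pow_sum, Finsupp.degree_eq_sum]
    _ ≤ ∑ x ∈ Fintype.piFinset (fun _ : σ => Finset.range (M + 1)), ∏ i, r ^ x i := by
        refine Finset.sum_le_sum_of_subset_of_nonneg (fun x hx => ?_)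
          fun _ _ _ => Finset.prod_nonneg fun _ _ => by positivity
        obtain ⟨N, hN, rfl⟩ := Finset.mem_image.1 hx
        refine Fintype.mem_piFinset.2 fun i => Finset.mem_range.2 (Nat.lt_succ_of_le ?_)
        exact (Finsupp.le_degree i N).trans (Finset.le_sup (f := fun N : σ →₀ ℕ => N.degree) hN)
    _ = ∏ _i : σ, ∑ k ∈ Finset.range (M + 1), r ^ k := (Finset.prod_univ_sum _ _).symm
    _ ≤ ∏ _i : σ, (1 - r)⁻¹ := by
        refine Finset.prod_le_prod (fun _ _ => Finset.sum_nonneg fun _ _ => by positivity)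
          fun _ _ => ?_
        rw [← tsum_geometric_of_lt_one h0 h1]
        exact (summable_geometric_of_lt_one h0 h1).sum_le_tsum _ fun _ _ => by positivity

/-- The factorial power absorbs `(2c) ^ |N|`, which leaves the summable factor `2 ^ (-|N|)`. This is
the source of convergence for the recursion, the product, the power series and nuclearity. -/
theorem summable_pow_mul_factorial_rpow {σ : Type*} [Finite σ] {c δ : ℝ} (hc : 0 ≤ c)
    (hδ : 0 < δ) :
    Summable fun N : σ →₀ ℕ => c ^ N.degree * (N.degree.factorial : ℝ) ^ (-δ) := by
  obtain ⟨C, hC, h⟩ := exists_pow_le_factorial_rpow (c := 2 * c) (by positivity) hδ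
  refine Summable.of_nonneg_of_le (fun N => by positivity) (fun N => ?_)
    ((summable_pow_degree (σ := σ) (r := 1 / 2) (by norm_num) (by norm_num)).mul_left C)
  have hk := h N.degree
  rw [Real.rpow_neg (by positivity), ← div_eq_mul_inv, div_le_iff₀ (by positivity), one_div,
    inv_pow, ← div_eq_mul_inv, div_mul_eq_mul_div, le_div_iff₀ (by positivity), mul_comm,
    ← mul_pow]
  exact hk

theorem factorial_add_le (a b : ℕ) :
    (a + b).factorial ≤ 2 ^ (a + b) * (a.factorial * b.factorial) := by
  rw [← Nat.add_choose_mul_factorial_mul_factorial a b, mul_assoc]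
  gcongr
  exact Nat.choose_le_two_pow _ _

/-- The multinomial coefficient is one of the nonnegative terms in the expansion of
$(1+\dots+1)^{|N|}$. -/
theorem factorial_sum_le {σ : Type*} [Fintype σ] (N : σ → ℕ) :
    (∑ i, N i).factorial ≤ Fintype.card σ ^ (∑ i, N i) * ∏ i, (N i).factorial := by
  classical
  rw [← Nat.multinomial_spec, mul_comm]
  gcongr
  have h := Finset.sum_pow_eq_sum_piAntidiag (Finset.univ : Finset σ) (fun _ => (1 : ℕ))
    (∑ i, N i)
  simp only [Finset.sum_const, Finset.card_univ, smul_eq_mul, mul_one, one_pow,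
    Finset.prod_const_one] at h
  rw [h]
  exact Finset.single_le_sum (f := fun k => Nat.multinomial Finset.univ k)
    (fun _ _ => Nat.zero_le _) (by simp [Finset.mem_piAntidiag])

/-! ### Iterated partial derivatives and the Wick star product -/

section Deriv

variable {n : ℕ}

/-- The multiindex `(N, 0)`. -/
def zIndex (N : Fin n → ℕ) : WickIndex n := Finsupp.equivFunOnFinite.symm (Sum.elim N 0)

/-- The multiindex `(0, N)`. -/
def zBarIndex (N : Fin n → ℕ) : WickIndex n := Finsupp.equivFunOnFinite.symm (Sum.elim 0 N)

@[simp] theorem zIndex_inl (N : Fin n → ℕ) (k : Fin n) : zIndex N (Sum.inl k) = N k := rfl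
@[simp] theorem zIndex_inr (N : Fin n → ℕ) (k : Fin n) : zIndex N (Sum.inr k) = 0 := rfl
@[simp] theorem zBarIndex_inl (N : Fin n → ℕ) (k : Fin n) : zBarIndex N (Sum.inl k) = 0 := rfl
@[simp] theorem zBarIndex_inr (N : Fin n → ℕ) (k : Fin n) : zBarIndex N (Sum.inr k) = N k := rfl

theorem degree_eq_sum_add_sum (α : WickIndex n) :
    α.degree = ∑ k, α (Sum.inl k) + ∑ k, α (Sum.inr k) := by
  rw [Finsupp.degree_eq_sum, Fintype.sum_sum_type]

@[simp] theorem degree_zIndex (N : Fin n → ℕ) : (zIndex N).degree = ∑ k, N k := by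
  simp [degree_eq_sum_add_sum]

@[simp] theorem degree_zBarIndex (N : Fin n → ℕ) : (zBarIndex N).degree = ∑ k, N k := by
  simp [degree_eq_sum_add_sum]

/-- No bound on `k` is required: where the subtraction of exponents truncates, the falling factorial
is zero. -/
theorem pderiv_pow_monomial {σ : Type*} (i : σ) (k : ℕ) (s : σ →₀ ℕ) (a : ℂ) :
    (((MvPolynomial.pderiv (R := ℂ) i).toLinearMap : Module.End ℂ (MvPolynomial σ ℂ)) ^ k)
      (MvPolynomial.monomial s a) =
    MvPolynomial.monomial (s - Finsupp.single i k) (a * ((s i).descFactorial k : ℕ)) := by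
  classical
  induction k with
  | zero => simp
  | succ k ih =>
    rw [pow_succ', Module.End.mul_apply, ih]
    change MvPolynomial.pderiv i _ = _
    rw [MvPolynomial.pderiv_monomial, tsub_tsub, ← Finsupp.single_add, Nat.descFactorial_succ]
    congr 1
    simp
    ring

/-- The variables in the list are distinct, so each power of a derivative sees the exponent of its
own variable untouched by the others. -/
theorem list_prod_pderiv_monomial {σ κ : Type*} (ι : κ → σ) (hι : Function.Injective ι)
    (N : κ → ℕ) (L : List κ) (hL : L.Nodup) (s : σ →₀ ℕ) (a : ℂ) :
    (L.map fun k => ((MvPolynomial.pderiv (R := ℂ) (ι k)).toLinearMap :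
      Module.End ℂ (MvPolynomial σ ℂ)) ^ N k).prod (MvPolynomial.monomial s a) =
    MvPolynomial.monomial (s - (L.map fun k => Finsupp.single (ι k) (N k)).sum)
      (a * (L.map fun k => (((s (ι k)).descFactorial (N k) : ℕ) : ℂ)).prod) := by
  classical
  induction L with
  | nil => simp
  | cons k L ih =>
    rw [List.nodup_cons] at hL
    have h0 : ∀ L : List κ, k ∉ L →
        (L.map fun k => Finsupp.single (ι k) (N k)).sum (ι k) = 0 := by
      intro L hk
      induction L with
      | nil => simp
      | cons j L ih' =>
        simp only [List.mem_cons, not_or] at hk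
        simp only [List.map_cons, List.sum_cons, Finsupp.add_apply, ih' hk.2, add_zero]
        rw [Finsupp.single_apply, if_neg fun h => hk.1 (hι h).symm]
    simp only [List.map_cons, List.prod_cons, List.sum_cons, Module.End.mul_apply]
    rw [ih hL.2, pderiv_pow_monomial, tsub_tsub, add_comm]
    congr 1
    simp only [Finsupp.tsub_apply, h0 L hL.1, Nat.sub_zero]
    ring

theorem derivZ_monomial (N : Fin n → ℕ) (s : WickIndex n) (a : ℂ) :
    derivZ N (MvPolynomial.monomial s a) = MvPolynomial.monomial (s - zIndex N)
      (a * ∏ k, (((s (Sum.inl k)).descFactorial (N k) : ℕ) : ℂ)) := by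
  rw [derivZ, List.ofFn_eq_map, list_prod_pderiv_monomial _ Sum.inl_injective _ _
    (List.nodup_finRange n)]
  congr 2
  · rw [← List.ofFn_eq_map, List.sum_ofFn]
    congr 1
    ext (k | k) <;> simp [Finsupp.finsetSum_apply, Finsupp.single_apply]

theorem derivZBar_monomial (N : Fin n → ℕ) (s : WickIndex n) (a : ℂ) :
    derivZBar N (MvPolynomial.monomial s a) = MvPolynomial.monomial (s - zBarIndex N)
      (a * ∏ k, (((s (Sum.inr k)).descFactorial (N k) : ℕ) : ℂ)) := by
  rw [derivZBar, List.ofFn_eq_map, list_prod_pderiv_monomial _ Sum.inr_injective _ _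
    (List.nodup_finRange n)]
  congr 2
  · rw [← List.ofFn_eq_map, List.sum_ofFn]
    congr 1
    ext (k | k) <;> simp [Finsupp.finsetSum_apply, Finsupp.single_apply]

/-- A `finsum` with infinite support is zero by convention; finiteness, already guaranteed by the
left factor, makes the star product a genuine sum. -/
theorem finite_support_derivZ (f : MvPolynomial (Fin n ⊕ Fin n) ℂ) :
    (Function.support fun N => derivZ N f).Finite := by
  induction f using MvPolynomial.induction_on' with
  | monomial s a =>
    refine (Set.finite_Iic (fun k => s (Sum.inl k))).subset fun N hN k => ?_
    by_contra hk
    refine hN ?_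
    simp only [derivZ_monomial]
    rw [Finset.prod_eq_zero (Finset.mem_univ k), mul_zero, map_zero]
    exact_mod_cast Nat.descFactorial_eq_zero_iff_lt.2 (not_le.1 hk)
  | add p q hp hq =>
    refine (hp.union hq).subset fun N hN => ?_
    by_contra h
    simp only [Set.mem_union, Function.mem_support, not_or, not_not] at h
    exact hN (by simp [h.1, h.2])

/-- The summand of index `N` of the Wick star product. -/
def starTerm (ħ : ℝ) (N : Fin n → ℕ) (f g : MvPolynomial (Fin n ⊕ Fin n) ℂ) :
    MvPolynomial (Fin n ⊕ Fin n) ℂ :=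
  MvPolynomial.C (((2 * ħ : ℝ) : ℂ) ^ (∑ k, N k) / ((∏ k, (N k).factorial : ℕ) : ℂ)) *
    (derivZ N f * derivZBar N g)

theorem polyStar_eq_finsum (ħ : ℝ) (f g : MvPolynomial (Fin n ⊕ Fin n) ℂ) :
    polyStar ħ f g = ∑ᶠ N, starTerm ħ N f g := rfl

theorem finite_support_starTerm (ħ : ℝ) (f g : MvPolynomial (Fin n ⊕ Fin n) ℂ) :
    (Function.support fun N => starTerm ħ N f g).Finite :=
  (finite_support_derivZ f).subset fun N hN h => hN (by simp [starTerm, h])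

/-- The Wick star product as a bilinear map. -/
def polyStarₗ (ħ : ℝ) : MvPolynomial (Fin n ⊕ Fin n) ℂ →ₗ[ℂ]
    MvPolynomial (Fin n ⊕ Fin n) ℂ →ₗ[ℂ] MvPolynomial (Fin n ⊕ Fin n) ℂ :=
  LinearMap.mk₂ ℂ (polyStar ħ)
    (fun f f' g => by
      simp only [polyStar_eq_finsum]
      rw [← finsum_add_distrib (finite_support_starTerm ..) (finite_support_starTerm ..)]
      exact finsum_congr fun N => by simp only [starTerm, map_add]; ring)
    (fun c f g => by
      simp only [polyStar_eq_finsum]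
      rw [smul_finsum]
      exact finsum_congr fun N => by
        simp only [starTerm, map_smul, smul_mul_assoc, mul_smul_comm])
    (fun f g g' => by
      simp only [polyStar_eq_finsum]
      rw [← finsum_add_distrib (finite_support_starTerm ..) (finite_support_starTerm ..)]
      exact finsum_congr fun N => by simp only [starTerm, map_add]; ring)
    (fun c f g => by
      simp only [polyStar_eq_finsum]
      rw [smul_finsum]
      exact finsum_congr fun N => by
        simp only [starTerm, map_smul, mul_smul_comm])

theorem one_polyStar (ħ : ℝ) (g : MvPolynomial (Fin n ⊕ Fin n) ℂ) : polyStar ħ 1 g = g := by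
  rw [polyStar_eq_finsum, finsum_eq_single _ 0]
  · simp [starTerm, derivZ, derivZBar]
  · intro N hN
    obtain ⟨k, hk⟩ := Function.ne_iff.1 hN
    have : derivZ N (1 : MvPolynomial (Fin n ⊕ Fin n) ℂ) = 0 := by
      rw [MvPolynomial.one_def, derivZ_monomial, Finset.prod_eq_zero (Finset.mem_univ k),
        mul_zero, map_zero]
      exact_mod_cast Nat.descFactorial_eq_zero_iff_lt.2 (Nat.pos_of_ne_zero hk)
    simp [starTerm, this]

theorem polyStar_one (ħ : ℝ) (g : MvPolynomial (Fin n ⊕ Fin n) ℂ) : polyStar ħ g 1 = g := by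
  rw [polyStar_eq_finsum, finsum_eq_single _ 0]
  · simp [starTerm, derivZ, derivZBar]
  · intro N hN
    obtain ⟨k, hk⟩ := Function.ne_iff.1 hN
    have : derivZBar N (1 : MvPolynomial (Fin n ⊕ Fin n) ℂ) = 0 := by
      rw [MvPolynomial.one_def, derivZBar_monomial, Finset.prod_eq_zero (Finset.mem_univ k),
        mul_zero, map_zero]
      exact_mod_cast Nat.descFactorial_eq_zero_iff_lt.2 (Nat.pos_of_ne_zero hk)
    simp [starTerm, this]

end Deriv

/-! ### Associativity of the Wick star product -/

section Assoc

variable {n : ℕ}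

theorem prod_factorial_add_single (M : Fin n → ℕ) (k : Fin n) :
    ∏ i, ((M + Pi.single k 1 : Fin n → ℕ) i).factorial = (M k + 1) * ∏ i, (M i).factorial := by
  have : ∀ i, ((M + Pi.single k 1 : Fin n → ℕ) i).factorial =
      (if i = k then M k + 1 else 1) * (M i).factorial := by
    intro i
    by_cases h : i = k
    · subst h; simp [Nat.factorial_succ]
    · simp [h]
  simp_rw [this]
  rw [Finset.prod_mul_distrib]
  simp

theorem sum_add_single (M : Fin n → ℕ) (k : Fin n) :
    ∑ i, (M + Pi.single k 1 : Fin n → ℕ) i = ∑ i, M i + 1 := by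
  simp [Finset.sum_add_distrib]

/-- The canonical commutation relation $[a,x]=1$ implies $[a^m,x]=m\,a^{m-1}$; for $m=0$ the
coefficient hides the truncated exponent. -/
theorem pow_mul_of_commutator_eq_one {R : Type*} [Ring R] {a x : R} (h : a * x = x * a + 1)
    (m : ℕ) : a ^ m * x = x * a ^ m + (m : R) * a ^ (m - 1) := by
  induction m with
  | zero => simp
  | succ m ih =>
    rw [pow_succ', mul_assoc, ih, mul_add, ← mul_assoc, h]
    rcases m with _ | m
    · simp
    · have : a * (((m + 1 : ℕ) : R) * a ^ m) = ((m + 1 : ℕ) : R) * (a * a ^ m) := by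
        rw [← mul_assoc, ← (Nat.cast_commute (m + 1) a).eq, mul_assoc]
      simp only [Nat.add_sub_cancel]
      rw [this, ← pow_succ']
      push_cast
      noncomm_ring

theorem list_prod_congr_of_notMem {R κ : Type*} [Monoid R] [DecidableEq κ] (a : κ → R)
    {N M : κ → ℕ} {k : κ} (hNM : ∀ i, i ≠ k → N i = M i) {L : List κ} (hk : k ∉ L) :
    (L.map fun i => a i ^ N i).prod = (L.map fun i => a i ^ M i).prod := by
  congr 1
  refine List.map_congr_left fun i hi => ?_
  rw [hNM i fun h => hk (h ▸ hi)]

/-- Moving `x` through the product meets exactly one factor that does not commute with it, namely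
the power of `a k`. -/
theorem list_prod_pow_mul {R κ : Type*} [Ring R] [DecidableEq κ] (a : κ → R) (x : R) (k : κ)
    (hx : ∀ i, i ≠ k → Commute (a i) x) (hk : a k * x = x * a k + 1) (N : κ → ℕ) (L : List κ)
    (hL : L.Nodup) (hkL : k ∈ L) :
    (L.map fun i => a i ^ N i).prod * x = x * (L.map fun i => a i ^ N i).prod +
      (N k : R) * (L.map fun i => a i ^ (N - Pi.single k 1 : κ → ℕ) i).prod := by
  induction L with
  | nil => simp at hkL
  | cons j L ih =>
    rw [List.nodup_cons] at hL
    simp only [List.map_cons, List.prod_cons]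
    by_cases hj : j = k
    · subst hj
      rw [← list_prod_congr_of_notMem a (N := N) (M := N - Pi.single j 1) (fun i hi => by simp [hi])
        hL.1]
      have hc : Commute (L.map fun i => a i ^ N i).prod x := by
        refine Commute.list_prod_left _ _ fun y hy => ?_
        obtain ⟨i, hi, rfl⟩ := List.mem_map.1 hy
        exact (hx i fun h => hL.1 (h ▸ hi)).pow_left _
      rw [mul_assoc, hc.eq, ← mul_assoc, pow_mul_of_commutator_eq_one hk]
      simp [add_mul, mul_assoc]
    · rw [mul_assoc, ih hL.2 ((List.mem_cons.1 hkL).resolve_left fun h => hj h.symm), mul_add,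
        ← mul_assoc, ((hx j hj).pow_left _).eq]
      congr 1
      · rw [mul_assoc]
      · rw [← mul_assoc, ← (Nat.cast_commute (N k) _).eq, mul_assoc]
        simp [hj]

theorem list_prod_pow_add_single {R κ : Type*} [Monoid R] [DecidableEq κ] (a : κ → R) (k : κ)
    (ha : ∀ i j, Commute (a i) (a j)) (N : κ → ℕ) (L : List κ) (hL : L.Nodup) (hkL : k ∈ L) :
    (L.map fun i => a i ^ (N + Pi.single k 1 : κ → ℕ) i).prod =
      (L.map fun i => a i ^ N i).prod * a k := by
  induction L with
  | nil => simp at hkL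
  | cons j L ih =>
    rw [List.nodup_cons] at hL
    simp only [List.map_cons, List.prod_cons]
    by_cases hj : j = k
    · subst hj
      rw [← list_prod_congr_of_notMem a (N := N) (M := N + Pi.single j 1) (fun i hi => by simp [hi])
        hL.1]
      have hc : Commute (L.map fun i => a i ^ N i).prod (a j) := by
        refine Commute.list_prod_left _ _ fun y hy => ?_
        obtain ⟨i, hi, rfl⟩ := List.mem_map.1 hy
        exact (ha _ _).pow_left _
      rw [mul_assoc, hc.eq, ← mul_assoc]
      simp [pow_succ]
    · rw [ih hL.2 ((List.mem_cons.1 hkL).resolve_left fun h => hj h.symm)]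
      simp [hj, mul_assoc]

/-- The partial derivative as an endomorphism of the vector space of polynomials. -/
def pderivEnd {σ : Type*} (i : σ) : Module.End ℂ (MvPolynomial σ ℂ) :=
  (MvPolynomial.pderiv (R := ℂ) i).toLinearMap

/-- The commutator of two derivations is a derivation, and this one kills all variables. -/
theorem pderivEnd_commute {σ : Type*} (i j : σ) : Commute (pderivEnd i) (pderivEnd j) := by
  classical
  have h : ⁅MvPolynomial.pderiv (R := ℂ) i, MvPolynomial.pderiv (R := ℂ) j⁆ = 0 := by
    refine MvPolynomial.derivation_ext fun k => ?_
    rw [Derivation.commutator_apply, MvPolynomial.pderiv_X, MvPolynomial.pderiv_X]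
    simp only [Pi.single_apply]
    split_ifs <;> simp
  refine LinearMap.ext fun f => ?_
  have := DFunLike.congr_fun h f
  rw [Derivation.commutator_apply] at this
  exact sub_eq_zero.1 this

theorem pderivEnd_mul_X_of_ne {σ : Type*} {i j : σ} (h : i ≠ j) :
    Commute (pderivEnd i) (LinearMap.mulLeft ℂ (MvPolynomial.X j : MvPolynomial σ ℂ)) := by
  refine LinearMap.ext fun f => ?_
  simp [pderivEnd, MvPolynomial.pderiv_X_of_ne h.symm]

theorem pderivEnd_mul_X {σ : Type*} (i : σ) :
    pderivEnd i * LinearMap.mulLeft ℂ (MvPolynomial.X i : MvPolynomial σ ℂ) =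
      LinearMap.mulLeft ℂ (MvPolynomial.X i : MvPolynomial σ ℂ) * pderivEnd i + 1 := by
  refine LinearMap.ext fun f => ?_
  simp [pderivEnd]

theorem derivZ_eq (N : Fin n → ℕ) :
    derivZ N = ((List.finRange n).map fun k => pderivEnd (Sum.inl k) ^ N k).prod := by
  rw [derivZ, List.ofFn_eq_map]; rfl

theorem derivZBar_eq (N : Fin n → ℕ) :
    derivZBar N = ((List.finRange n).map fun k => pderivEnd (Sum.inr k) ^ N k).prod := by
  rw [derivZBar, List.ofFn_eq_map]; rfl

theorem commute_derivZ {x : Module.End ℂ (MvPolynomial (Fin n ⊕ Fin n) ℂ)}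
    (h : ∀ k, Commute (pderivEnd (Sum.inl k)) x) (N : Fin n → ℕ) : Commute (derivZ N) x := by
  rw [derivZ_eq]
  refine Commute.list_prod_left _ _ fun y hy => ?_
  obtain ⟨i, hi, rfl⟩ := List.mem_map.1 hy
  exact (h i).pow_left _

theorem commute_derivZBar {x : Module.End ℂ (MvPolynomial (Fin n ⊕ Fin n) ℂ)}
    (h : ∀ k, Commute (pderivEnd (Sum.inr k)) x) (N : Fin n → ℕ) : Commute (derivZBar N) x := by
  rw [derivZBar_eq]
  refine Commute.list_prod_left _ _ fun y hy => ?_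
  obtain ⟨i, hi, rfl⟩ := List.mem_map.1 hy
  exact (h i).pow_left _

theorem derivZ_X_inr_mul (N : Fin n → ℕ) (k : Fin n) (f : MvPolynomial (Fin n ⊕ Fin n) ℂ) :
    derivZ N (MvPolynomial.X (Sum.inr k) * f) = MvPolynomial.X (Sum.inr k) * derivZ N f :=
  LinearMap.congr_fun (commute_derivZ (fun _ => pderivEnd_mul_X_of_ne Sum.inl_ne_inr) N).eq f

theorem derivZ_X_inl_mul (N : Fin n → ℕ) (k : Fin n) (f : MvPolynomial (Fin n ⊕ Fin n) ℂ) :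
    derivZ N (MvPolynomial.X (Sum.inl k) * f) = MvPolynomial.X (Sum.inl k) * derivZ N f +
      (N k : ℂ) • derivZ (N - Pi.single k 1) f := by
  have := list_prod_pow_mul (fun i : Fin n => pderivEnd (Sum.inl i : Fin n ⊕ Fin n))
    (LinearMap.mulLeft ℂ (MvPolynomial.X (Sum.inl k))) k
    (fun i hi => pderivEnd_mul_X_of_ne fun h => hi (Sum.inl_injective h))
    (pderivEnd_mul_X _) N _ (List.nodup_finRange n) (List.mem_finRange k)
  rw [← derivZ_eq, ← derivZ_eq] at this
  have h := LinearMap.congr_fun this f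
  simpa [Module.End.mul_apply, Nat.cast_smul_eq_nsmul] using h

theorem derivZBar_add_single (N : Fin n → ℕ) (k : Fin n) :
    derivZBar (N + Pi.single k 1) = derivZBar N * pderivEnd (Sum.inr k) := by
  rw [derivZBar_eq, derivZBar_eq, list_prod_pow_add_single
    (fun i : Fin n => pderivEnd (Sum.inr i : Fin n ⊕ Fin n)) k
    (fun i j => pderivEnd_commute _ _) N _ (List.nodup_finRange n) (List.mem_finRange k)]

theorem polyStar_add_left (ħ : ℝ) (f g h : MvPolynomial (Fin n ⊕ Fin n) ℂ) :
    polyStar ħ (f + g) h = polyStar ħ f h + polyStar ħ g h :=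
  (polyStarₗ ħ).map_add₂ f g h

theorem polyStar_add_right (ħ : ℝ) (f g h : MvPolynomial (Fin n ⊕ Fin n) ℂ) :
    polyStar ħ f (g + h) = polyStar ħ f g + polyStar ħ f h :=
  (polyStarₗ ħ f).map_add g h

theorem polyStar_smul_left (ħ : ℝ) (c : ℂ) (f h : MvPolynomial (Fin n ⊕ Fin n) ℂ) :
    polyStar ħ (c • f) h = c • polyStar ħ f h :=
  (polyStarₗ ħ).map_smul₂ c f h

theorem X_inr_mul_polyStar (ħ : ℝ) (k : Fin n) (f g : MvPolynomial (Fin n ⊕ Fin n) ℂ) :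
    polyStar ħ (MvPolynomial.X (Sum.inr k) * f) g =
      MvPolynomial.X (Sum.inr k) * polyStar ħ f g := by
  rw [polyStar_eq_finsum, polyStar_eq_finsum, mul_finsum' _ _ (finite_support_starTerm ħ f g)]
  refine finsum_congr fun N => ?_
  rw [starTerm, starTerm, derivZ_X_inr_mul]
  ring

/-- The star product is built from constant-coefficient operators, which commute with ∂/∂z̄; the
Leibniz rule therefore holds term by term. -/
theorem pderivEnd_polyStar (ħ : ℝ) (k : Fin n) (f g : MvPolynomial (Fin n ⊕ Fin n) ℂ) :
    pderivEnd (Sum.inr k) (polyStar ħ f g) =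
      polyStar ħ (pderivEnd (Sum.inr k) f) g + polyStar ħ f (pderivEnd (Sum.inr k) g) := by
  simp only [polyStar_eq_finsum]
  refine ((pderivEnd (Sum.inr k)).toAddMonoidHom.map_finsum
    (finite_support_starTerm ħ f g)).trans ?_
  rw [← finsum_add_distrib (finite_support_starTerm ..) (finite_support_starTerm ..)]
  refine finsum_congr fun N => ?_
  have h1 := LinearMap.congr_fun
    (commute_derivZ (fun _ => pderivEnd_commute _ (Sum.inr k)) N).eq f
  have h2 := LinearMap.congr_fun
    (commute_derivZBar (fun _ => pderivEnd_commute _ (Sum.inr k)) N).eq g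
  simp only [Module.End.mul_apply] at h1 h2
  simp only [starTerm, h1, h2]
  simp only [LinearMap.toAddMonoidHom_coe, pderivEnd, Derivation.coeFn_coe, Derivation.leibniz,
    MvPolynomial.pderiv_C, smul_eq_mul]
  ring

/-- Commuting $z^k$ past $\partial^N/\partial z^N$ leaves $N_k\,\partial^{N-e_k}$. The factor $N_k$
cancels against $N!$, and the shift $N=M+e_k$ transfers one derivative to the right factor together
with one power of $2\hbar$. -/
theorem X_inl_mul_polyStar (ħ : ℝ) (k : Fin n) (f g : MvPolynomial (Fin n ⊕ Fin n) ℂ) :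
    polyStar ħ (MvPolynomial.X (Sum.inl k) * f) g =
      MvPolynomial.X (Sum.inl k) * polyStar ħ f g +
        ((2 * ħ : ℝ) : ℂ) • polyStar ħ f (pderivEnd (Sum.inr k) g) := by
  -- The commutator contributions. They vanish when `N k = 0`, so reindexing by the shift loses
  -- nothing.
  let G : (Fin n → ℕ) → MvPolynomial (Fin n ⊕ Fin n) ℂ := fun N =>
    MvPolynomial.C (((2 * ħ : ℝ) : ℂ) ^ (∑ k, N k) / ((∏ k, (N k).factorial : ℕ) : ℂ)) *
      ((N k : ℂ) • derivZ (N - Pi.single k 1) f * derivZBar N g)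
  have hsum : ∀ N, starTerm ħ N (MvPolynomial.X (Sum.inl k) * f) g =
      MvPolynomial.X (Sum.inl k) * starTerm ħ N f g + G N := by
    intro N
    simp only [G, starTerm, derivZ_X_inl_mul]
    ring
  have hG : ∀ M, G (M + Pi.single k 1) =
      ((2 * ħ : ℝ) : ℂ) • starTerm ħ M f (pderivEnd (Sum.inr k) g) := by
    intro M
    simp only [G, starTerm]
    rw [derivZBar_add_single, prod_factorial_add_single, sum_add_single, add_tsub_cancel_right,
      Module.End.mul_apply, MvPolynomial.smul_eq_C_mul, MvPolynomial.smul_eq_C_mul]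
    have h1 : ((∏ i, (M i).factorial : ℕ) : ℂ) ≠ 0 := by
      exact_mod_cast Finset.prod_ne_zero_iff.2 fun i _ => Nat.factorial_ne_zero (M i)
    have h2 : ((M k : ℂ) + 1) ≠ 0 := by exact_mod_cast Nat.succ_ne_zero (M k)
    have hC : (((2 * ħ : ℝ) : ℂ) ^ (∑ i, M i + 1) /
          (((M k + 1) * ∏ i, (M i).factorial : ℕ) : ℂ)) * (((M + Pi.single k 1 : Fin n → ℕ) k : ℕ) : ℂ) =
        ((2 * ħ : ℝ) : ℂ) *
          (((2 * ħ : ℝ) : ℂ) ^ (∑ i, M i) / ((∏ i, (M i).factorial : ℕ) : ℂ)) := by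
      simp only [Pi.add_apply, Pi.single_eq_same]
      push_cast at h1 ⊢
      field_simp
      ring
    have hC' := congrArg (MvPolynomial.C (σ := Fin n ⊕ Fin n)) hC
    rw [map_mul, map_mul] at hC'
    rw [← mul_assoc, ← mul_assoc, ← mul_assoc, ← mul_assoc, hC']
  have hinj : Function.Injective fun M : Fin n → ℕ => M + Pi.single k 1 :=
    add_left_injective _
  have hsupp : Function.support G ⊆ Set.range fun M : Fin n → ℕ => M + Pi.single k 1 := by
    intro N hN
    refine ⟨N - Pi.single k 1, funext fun i => ?_⟩
    by_cases hi : i = k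
    · subst hi
      have : N i ≠ 0 := fun h => hN (by simp [G, h])
      simp only [Pi.add_apply, Pi.sub_apply, Pi.single_eq_same]
      omega
    · simp [hi]
  have hfin : (Function.support G).Finite := by
    have h := (finite_support_starTerm ħ f (pderivEnd (Sum.inr k) g)).image
      fun M : Fin n → ℕ => M + Pi.single k 1
    refine h.subset fun N hN => ?_
    obtain ⟨M, rfl⟩ := hsupp hN
    refine ⟨M, fun h0 => hN ?_, rfl⟩
    exact (hG M).trans ((congrArg _ h0).trans (smul_zero _))
  have hGs : ∑ᶠ N, G N = ((2 * ħ : ℝ) : ℂ) • polyStar ħ f (pderivEnd (Sum.inr k) g) := by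
    rw [← finsum_mem_univ, ← finsum_mem_inter_support, Set.univ_inter,
      ← Set.inter_eq_right.2 hsupp, finsum_mem_inter_support, finsum_mem_range hinj,
      polyStar_eq_finsum, smul_finsum]
    exact finsum_congr hG
  rw [← hGs, polyStar_eq_finsum, polyStar_eq_finsum, mul_finsum' _ _ (finite_support_starTerm ħ f g),
    ← finsum_add_distrib _ hfin]
  · exact finsum_congr hsum
  · refine (finite_support_starTerm ħ f g).subset fun N hN h => hN ?_
    simp only [h, mul_zero]

/-- Induction on the left factor, one variable at a time: z̄ passes through the product, while z
produces $2\hbar\,f\star\partial_{\bar z}g$, and both sides agree because $\partial_{\bar z}$ is a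
derivation of ⋆. -/
theorem polyStar_assoc (ħ : ℝ) (f g h : MvPolynomial (Fin n ⊕ Fin n) ℂ) :
    polyStar ħ (polyStar ħ f g) h = polyStar ħ f (polyStar ħ g h) := by
  induction f using MvPolynomial.induction_on generalizing g h with
  | C a =>
    have : (MvPolynomial.C a : MvPolynomial (Fin n ⊕ Fin n) ℂ) = a • 1 := by
      rw [MvPolynomial.smul_eq_C_mul, mul_one]
    rw [this]
    simp only [polyStar_smul_left, one_polyStar]
  | add p q hp hq => simp only [polyStar_add_left, hp, hq]
  | mul_X p i hp =>
    rw [mul_comm]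
    rcases i with k | k
    · simp only [X_inl_mul_polyStar, polyStar_add_left, polyStar_smul_left, hp,
        pderivEnd_polyStar, polyStar_add_right, smul_add]
      abel
    · simp only [X_inr_mul_polyStar, hp]

end Assoc

/-! ### The structure constants of the Wick star product -/

section StructureConst

variable {n : ℕ} {ħ : ℝ} (hħ : 0 < ħ)

theorem wickBasis_apply (N : WickIndex n) :
    wickBasis n hħ N = MvPolynomial.monomial N (wickScale n ħ N) := by
  change Module.Basis.isUnitSMul (MvPolynomial.basisMonomials (Fin n ⊕ Fin n) ℂ)
    (isUnit_wickScale n hħ) N = _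
  rw [Module.Basis.isUnitSMul_apply, MvPolynomial.coe_basisMonomials]
  simp [MvPolynomial.smul_monomial]

theorem wickBasis_repr (f : WickAlgebra n hħ) (N : WickIndex n) :
    (wickBasis n hħ).repr f N = (wickScale n ħ N)⁻¹ * MvPolynomial.coeff N
      (show MvPolynomial (Fin n ⊕ Fin n) ℂ from f) := by
  refine (Module.Basis.repr_isUnitSMul (v := MvPolynomial.basisMonomials (Fin n ⊕ Fin n) ℂ)
    (isUnit_wickScale n hħ) f N).trans ?_
  rw [Units.smul_def, smul_eq_mul, Units.val_inv_eq_inv_val]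
  rfl

theorem starTerm_monomial (N : Fin n → ℕ) (s t : WickIndex n) (a b : ℂ) :
    starTerm ħ N (MvPolynomial.monomial s a) (MvPolynomial.monomial t b) =
      MvPolynomial.monomial (s - zIndex N + (t - zBarIndex N))
        (((2 * ħ : ℝ) : ℂ) ^ (∑ k, N k) / ((∏ k, (N k).factorial : ℕ) : ℂ) *
          ((a * ∏ k, (((s (Sum.inl k)).descFactorial (N k) : ℕ) : ℂ)) *
          (b * ∏ k, (((t (Sum.inr k)).descFactorial (N k) : ℕ) : ℂ)))) := by
  rw [starTerm, derivZ_monomial, derivZBar_monomial, MvPolynomial.monomial_mul,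
    MvPolynomial.C_mul_monomial]

/-- A nonzero coefficient forces the falling factorials to be nonzero, so neither subtraction of
exponents truncates. -/
theorem of_coeff_starTerm_ne_zero {N : Fin n → ℕ} {s t γ : WickIndex n} {a b : ℂ}
    (h : MvPolynomial.coeff γ
      (starTerm ħ N (MvPolynomial.monomial s a) (MvPolynomial.monomial t b)) ≠ 0) :
    zIndex N ≤ s ∧ zBarIndex N ≤ t ∧ γ = s - zIndex N + (t - zBarIndex N) := by
  classical
  rw [starTerm_monomial, MvPolynomial.coeff_monomial] at h
  split_ifs at h with h0
  · have h1 := right_ne_zero_of_mul (left_ne_zero_of_mul (right_ne_zero_of_mul h))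
    have h2 := right_ne_zero_of_mul (right_ne_zero_of_mul (right_ne_zero_of_mul h))
    rw [Finset.prod_ne_zero_iff] at h1 h2
    refine ⟨?_, ?_, h0.symm⟩
    · rintro (k | k)
      · have := h1 k (Finset.mem_univ k)
        rw [Nat.cast_ne_zero, Ne, Nat.descFactorial_eq_zero_iff_lt, not_lt] at this
        exact this
      · exact Nat.zero_le _
    · rintro (k | k)
      · exact Nat.zero_le _
      · have := h2 k (Finset.mem_univ k)
        rw [Nat.cast_ne_zero, Ne, Nat.descFactorial_eq_zero_iff_lt, not_lt] at this
        exact this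
  · exact absurd rfl h

theorem structureConst_eq_finsum (α β γ : WickIndex n) :
    structureConst (wickBasis n hħ) (wickStar hħ) α β γ = ∑ᶠ N, (wickScale n ħ γ)⁻¹ *
      MvPolynomial.coeff γ (starTerm ħ N (MvPolynomial.monomial α (wickScale n ħ α))
        (MvPolynomial.monomial β (wickScale n ħ β))) := by
  rw [structureConst, wickBasis_repr, wickBasis_apply, wickBasis_apply]
  change _ * MvPolynomial.coeff γ (polyStar ħ _ _) = _
  have h := (MvPolynomial.coeffAddMonoidHom (R := ℂ) γ).map_finsum
    (finite_support_starTerm ħ (MvPolynomial.monomial α (wickScale n ħ α))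
        (MvPolynomial.monomial β (wickScale n ħ β)))
  rw [polyStar_eq_finsum, ← mul_finsum]
  exact congrArg _ h

/-- This is the effect of the normalisation: $\partial_z^N
e_{(N,0)+\alpha}=(2\hbar)^{-|N|}e_\alpha$. -/
theorem wickScale_zIndex_add (hħ : 0 < ħ) (N : Fin n → ℕ) (α : WickIndex n) :
    wickScale n ħ (zIndex N + α) *
      ∏ k, ((((zIndex N + α) (Sum.inl k)).descFactorial (N k) : ℕ) : ℂ) =
    wickScale n ħ α / ((2 * ħ : ℝ) : ℂ) ^ (∑ k, N k) := by
  have h : ∏ k, ((zIndex N + α) k).factorial = (∏ k, (α k).factorial) *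
      ∏ k, ((zIndex N + α) (Sum.inl k)).descFactorial (N k) := by
    have hk : ∏ k, ((zIndex N + α) (Sum.inl k)).factorial = (∏ k, (α (Sum.inl k)).factorial) *
        ∏ k, ((zIndex N + α) (Sum.inl k)).descFactorial (N k) := by
      rw [← Finset.prod_mul_distrib]
      refine Finset.prod_congr rfl fun k _ => ?_
      rw [← Nat.factorial_mul_descFactorial (n := (zIndex N + α) (Sum.inl k)) (k := N k) (by simp)]
      simp
    have hr : ∏ k, ((zIndex N + α) (Sum.inr k)).factorial = ∏ k, (α (Sum.inr k)).factorial := by simp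
    rw [Fintype.prod_sum_type, Fintype.prod_sum_type, hk, hr]
    ring
  have h1 : ((∏ k, (α k).factorial : ℕ) : ℂ) ≠ 0 := by
    exact_mod_cast Finset.prod_ne_zero_iff.2 fun i _ => Nat.factorial_ne_zero _
  have h2 : ((∏ k, ((zIndex N + α) (Sum.inl k)).descFactorial (N k) : ℕ) : ℂ) ≠ 0 := by
    have : ∏ k, ((zIndex N + α) k).factorial ≠ 0 :=
      Finset.prod_ne_zero_iff.2 fun i _ => Nat.factorial_ne_zero _
    rw [h] at this
    exact_mod_cast right_ne_zero_of_mul this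
  rw [wickScale, wickScale, h, map_add, degree_zIndex, ← Nat.cast_prod, Nat.cast_mul, pow_add]
  have h3 : ((2 * ħ : ℝ) : ℂ) ≠ 0 := by exact_mod_cast (by positivity : (2 * ħ : ℝ) ≠ 0)
  have h4 := pow_ne_zero (∑ k, N k) h3
  have h5 := pow_ne_zero α.degree h3
  rw [div_mul_eq_mul_div, one_mul, div_div, div_eq_div_iff (by simp only [mul_ne_zero_iff]; tauto)
    (by simp only [mul_ne_zero_iff]; tauto)]
  ring

theorem wickScale_zBarIndex_add (hħ : 0 < ħ) (N : Fin n → ℕ) (α : WickIndex n) :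
    wickScale n ħ (zBarIndex N + α) *
      ∏ k, ((((zBarIndex N + α) (Sum.inr k)).descFactorial (N k) : ℕ) : ℂ) =
    wickScale n ħ α / ((2 * ħ : ℝ) : ℂ) ^ (∑ k, N k) := by
  have h : ∏ k, ((zBarIndex N + α) k).factorial = (∏ k, (α k).factorial) *
      ∏ k, ((zBarIndex N + α) (Sum.inr k)).descFactorial (N k) := by
    have hk : ∏ k, ((zBarIndex N + α) (Sum.inr k)).factorial = (∏ k, (α (Sum.inr k)).factorial) *
        ∏ k, ((zBarIndex N + α) (Sum.inr k)).descFactorial (N k) := by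
      rw [← Finset.prod_mul_distrib]
      refine Finset.prod_congr rfl fun k _ => ?_
      rw [← Nat.factorial_mul_descFactorial (n := (zBarIndex N + α) (Sum.inr k)) (k := N k) (by simp)]
      simp
    have hr : ∏ k, ((zBarIndex N + α) (Sum.inl k)).factorial = ∏ k, (α (Sum.inl k)).factorial := by simp
    rw [Fintype.prod_sum_type, Fintype.prod_sum_type, hk, hr]
    ring
  have h1 : ((∏ k, (α k).factorial : ℕ) : ℂ) ≠ 0 := by
    exact_mod_cast Finset.prod_ne_zero_iff.2 fun i _ => Nat.factorial_ne_zero _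
  have h2 : ((∏ k, ((zBarIndex N + α) (Sum.inr k)).descFactorial (N k) : ℕ) : ℂ) ≠ 0 := by
    have : ∏ k, ((zBarIndex N + α) k).factorial ≠ 0 :=
      Finset.prod_ne_zero_iff.2 fun i _ => Nat.factorial_ne_zero _
    rw [h] at this
    exact_mod_cast right_ne_zero_of_mul this
  rw [wickScale, wickScale, h, map_add, degree_zBarIndex, ← Nat.cast_prod, Nat.cast_mul, pow_add]
  have h3 : ((2 * ħ : ℝ) : ℂ) ≠ 0 := by exact_mod_cast (by positivity : (2 * ħ : ℝ) ≠ 0)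
  have h4 := pow_ne_zero (∑ k, N k) h3
  have h5 := pow_ne_zero α.degree h3
  rw [div_mul_eq_mul_div, one_mul, div_div, div_eq_div_iff (by simp only [mul_ne_zero_iff]; tauto)
    (by simp only [mul_ne_zero_iff]; tauto)]
  ring

/-- The pointwise product of basis vectors is $e_\alpha
e_\beta=\binom{\alpha+\beta}{\alpha}e_{\alpha+\beta}$. -/
theorem wickScale_mul_div (hħ : 0 < ħ) (α β : WickIndex n) :
    (wickScale n ħ (α + β))⁻¹ * (wickScale n ħ α * wickScale n ħ β) =
      ((∏ k, (α k + β k).choose (α k) : ℕ) : ℂ) := by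
  have h3 : ((2 * ħ : ℝ) : ℂ) ≠ 0 := by exact_mod_cast (by positivity : (2 * ħ : ℝ) ≠ 0)
  have h : ∏ k, ((α + β) k).factorial = (∏ k, (α k + β k).choose (α k)) *
      ((∏ k, (α k).factorial) * ∏ k, (β k).factorial) := by
    rw [← Finset.prod_mul_distrib, ← Finset.prod_mul_distrib]
    refine Finset.prod_congr rfl fun k _ => ?_
    rw [Finsupp.add_apply, ← Nat.add_choose_mul_factorial_mul_factorial, mul_assoc,
      Nat.choose_symm_add]
  have hf : ∀ γ : WickIndex n, ((∏ k, (γ k).factorial : ℕ) : ℂ) ≠ 0 := fun γ => by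
    exact_mod_cast Finset.prod_ne_zero_iff.2 fun i _ => Nat.factorial_ne_zero _
  have h4 := pow_ne_zero α.degree h3
  have h5 := pow_ne_zero β.degree h3
  have h1 := hf α
  have h2 := hf β
  rw [wickScale, wickScale, wickScale, h, map_add, Nat.cast_mul, Nat.cast_mul, pow_add, one_div,
    inv_inv, div_mul_div_comm, one_mul, mul_one_div, div_eq_iff
      (by simp only [Ne, mul_eq_zero, not_or]; tauto)]
  ring

/-- The three indices determine `N`, so a single term of the star product contributes. The two
derivatives yield $(2\hbar)^{-2|N|}$ against the prefactor $(2\hbar)^{|N|}/N!$. -/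
theorem structureConst_eq (N : Fin n → ℕ) (α β : WickIndex n) :
    structureConst (wickBasis n hħ) (wickStar hħ) (zIndex N + α) (zBarIndex N + β) (α + β) =
      ((∏ k, (α k + β k).choose (α k) : ℕ) : ℂ) /
        (((2 * ħ : ℝ) : ℂ) ^ (∑ k, N k) * ((∏ k, (N k).factorial : ℕ) : ℂ)) := by
  rw [structureConst_eq_finsum, finsum_eq_single _ N]
  · have h3 : ((2 * ħ : ℝ) : ℂ) ≠ 0 := by exact_mod_cast (by positivity : (2 * ħ : ℝ) ≠ 0)
    have h4 := pow_ne_zero (∑ k, N k) h3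
    have hf : ((∏ k, (N k).factorial : ℕ) : ℂ) ≠ 0 := by
      exact_mod_cast Finset.prod_ne_zero_iff.2 fun i _ => Nat.factorial_ne_zero _
    rw [starTerm_monomial, add_tsub_cancel_left, add_tsub_cancel_left, MvPolynomial.coeff_monomial,
      if_pos rfl, wickScale_zIndex_add hħ, wickScale_zBarIndex_add hħ, ← wickScale_mul_div hħ]
    generalize ((2 * ħ : ℝ) : ℂ) ^ (∑ k, N k) = x at *
    field_simp
  · intro M hM
    by_contra h
    obtain ⟨h1, h2, h3⟩ := of_coeff_starTerm_ne_zero (right_ne_zero_of_mul h)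
    refine hM (funext fun k => ?_)
    have e1 := DFunLike.congr_fun h3 (Sum.inl k)
    have e2 := h1 (Sum.inl k)
    simp at e1 e2
    omega

theorem exists_of_structureConst_ne_zero {α β γ : WickIndex n}
    (h : structureConst (wickBasis n hħ) (wickStar hħ) α β γ ≠ 0) :
    ∃ (N : Fin n → ℕ) (α' β' : WickIndex n), α = zIndex N + α' ∧ β = zBarIndex N + β' ∧
      γ = α' + β' := by
  rw [structureConst_eq_finsum] at h
  obtain ⟨N, hN⟩ : ∃ N, _ ≠ _ := by
    by_contra! hN
    exact h ((finsum_congr hN).trans finsum_zero)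
  obtain ⟨h1, h2, h3⟩ := of_coeff_starTerm_ne_zero (right_ne_zero_of_mul hN)
  exact ⟨N, _, _, (add_tsub_cancel_of_le h1).symm, (add_tsub_cancel_of_le h2).symm, h3⟩

/-- Reflects $e_0=1$. With its left counterpart it lets the recursion stay at a fixed index without
loss. -/
theorem structureConst_zero_right (γ : WickIndex n) :
    structureConst (wickBasis n hħ) (wickStar hħ) γ 0 γ = 1 := by
  have h := structureConst_eq hħ 0 γ 0
  have h0 : zIndex (0 : Fin n → ℕ) = 0 := by ext (k | k) <;> rfl
  have h1 : zBarIndex (0 : Fin n → ℕ) = 0 := by ext (k | k) <;> rfl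
  simpa [h0, h1] using h

theorem structureConst_zero_left (γ : WickIndex n) :
    structureConst (wickBasis n hħ) (wickStar hħ) 0 γ γ = 1 := by
  have h := structureConst_eq hħ 0 0 γ
  have h0 : zIndex (0 : Fin n → ℕ) = 0 := by ext (k | k) <;> rfl
  have h1 : zBarIndex (0 : Fin n → ℕ) = 0 := by ext (k | k) <;> rfl
  simpa [h0, h1] using h

theorem prod_factorial_le_factorial_degree (N : Fin n → ℕ) :
    ∏ k, (N k).factorial ≤ (∑ k, N k).factorial :=
  Nat.le_of_dvd (Nat.factorial_pos _) (Nat.prod_factorial_dvd_factorial_sum _ _)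

/-- A lower bound for those structure constants that let the indices of a coefficient
move to zero. -/
theorem exists_one_le_norm_structureConst (n : ℕ) {ħ : ℝ} (hħ : 0 < ħ) :
    ∃ c : ℝ, 1 ≤ c ∧ ∀ α : WickIndex n, ∃ μ β α',
      1 ≤ c ^ α.degree * (α.degree.factorial : ℝ) *
        ‖structureConst (wickBasis n hħ) (wickStar hħ) α β μ‖ ∧
      1 ≤ c ^ α.degree * (α.degree.factorial : ℝ) *
        ‖structureConst (wickBasis n hħ) (wickStar hħ) α' μ 0‖ := by
  refine ⟨max 1 (2 * ħ), le_max_left _ _, fun α => ?_⟩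
  let I : Fin n → ℕ := fun k => α (Sum.inl k)
  let J : Fin n → ℕ := fun k => α (Sum.inr k)
  have hα : α = zIndex I + zBarIndex J := by ext (k | k) <;> simp [I, J]
  have hI : ∑ k, I k ≤ α.degree := by rw [degree_eq_sum_add_sum]; exact Nat.le_add_right _ _
  have hJ : ∑ k, J k ≤ α.degree := by rw [degree_eq_sum_add_sum]; exact Nat.le_add_left _ _
  have key : ∀ N : Fin n → ℕ, ∑ k, N k ≤ α.degree →
      1 ≤ (max 1 (2 * ħ)) ^ α.degree * (α.degree.factorial : ℝ) *
        ‖(1 : ℂ) / (((2 * ħ : ℝ) : ℂ) ^ (∑ k, N k) * ((∏ k, (N k).factorial : ℕ) : ℂ))‖ := by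
    intro N hN
    rw [norm_div, norm_one, norm_mul, norm_pow, Complex.norm_real, Real.norm_of_nonneg
      (by positivity), Complex.norm_natCast, mul_one_div, one_le_div]
    · gcongr
      · exact (pow_le_pow_left₀ (by positivity) (le_max_right _ _) _).trans
          (pow_le_pow_right₀ (le_max_left _ _) hN)
      · exact (prod_factorial_le_factorial_degree N).trans (Nat.factorial_le hN)
    · have : 0 < ∏ k, (N k).factorial := Finset.prod_pos fun _ _ => Nat.factorial_pos _
      positivity
  -- For α = (I, J), pairing with (0, I) on the right strips the z-part and leads to μ = (0, J);
  -- pairing with (J, 0) on the left strips the rest and leads to 0.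
  refine ⟨zBarIndex J, zBarIndex I, zIndex J, ?_, ?_⟩
  · have h := structureConst_eq hħ I (zBarIndex J) 0
    rw [add_zero, add_zero, ← hα] at h
    rw [h]
    simpa using key I hI
  · have h := structureConst_eq hħ J (0 : WickIndex n) 0
    rw [add_zero, add_zero, add_zero] at h
    rw [h]
    simpa using key J hJ

/-- The upper bound for the structure constants. -/
theorem exists_norm_structureConst_le (n : ℕ) {ħ : ℝ} (hħ : 0 < ħ) :
    ∃ c : ℝ, 1 ≤ c ∧ ∀ η : ℝ, 0 ≤ η → 2 * η ≤ 1 → ∀ α β γ : WickIndex n,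
      ‖structureConst (wickBasis n hħ) (wickStar hħ) α β γ‖ ≤
        (c ^ α.degree * (α.degree.factorial : ℝ) ^ (-η)) *
        ((c ^ β.degree * (β.degree.factorial : ℝ) ^ (-η)) *
        (c ^ γ.degree * (γ.degree.factorial : ℝ) ^ (2 * η))) := by
  let b : ℝ := max 1 (1 / (2 * ħ))
  -- The factor `b` pays for `(2ħ) ^ (-m)`, `n + 1` for comparing $N!$ with $|N|!$ (and stays
  -- positive for `n = 0`), and 4 for the powers of 2 from binomials and factorials.
  let c : ℝ := 4 * b * (n + 1)
  have hb : 1 ≤ b := le_max_left _ _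
  have hn : (1 : ℝ) ≤ n + 1 := by simp
  have hc4 : 4 ≤ c := by
    have : 1 ≤ b * (n + 1) := one_le_mul_of_one_le_of_one_le hb hn
    simp only [c]; nlinarith
  have hcb : 2 * (b * (n + 1)) ≤ c := by
    have : 1 ≤ b * (n + 1) := one_le_mul_of_one_le_of_one_le hb hn
    simp only [c]; nlinarith
  have hc1 : 1 ≤ c := by linarith
  refine ⟨c, hc1, fun η h0 h1 α β γ => ?_⟩
  by_cases h : structureConst (wickBasis n hħ) (wickStar hħ) α β γ = 0
  · rw [h, norm_zero]; positivity
  obtain ⟨N, α', β', rfl, rfl, rfl⟩ := exists_of_structureConst_ne_zero hħ h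
  rw [structureConst_eq]
  set m := ∑ k, N k
  have hdα : (zIndex N + α').degree = m + α'.degree := by rw [map_add, degree_zIndex]
  have hdβ : (zBarIndex N + β').degree = m + β'.degree := by rw [map_add, degree_zBarIndex]
  rw [hdα, hdβ]
  have hdγ : (α' + β').degree = α'.degree + β'.degree := map_add _ _ _
  set g := (α' + β').degree
  -- the bound of a single term
  have hchoose : ((∏ k, (α' k + β' k).choose (α' k) : ℕ) : ℝ) ≤ 2 ^ g := by
    have : ∏ k, (α' k + β' k).choose (α' k) ≤ 2 ^ g := by
      rw [show g = ∑ k, (α' k + β' k) from Finsupp.degree_eq_sum _, ← Finset.prod_pow_eq_pow_sum]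
      exact Finset.prod_le_prod' fun k _ => Nat.choose_le_two_pow _ _
    exact_mod_cast this
  have hP : 0 < ((∏ k, (N k).factorial : ℕ) : ℝ) := by
    exact_mod_cast Finset.prod_pos fun _ _ => Nat.factorial_pos _
  have hfac : 1 / ((∏ k, (N k).factorial : ℕ) : ℝ) ≤ (n + 1) ^ m / m.factorial := by
    rw [div_le_div_iff₀ hP (by positivity), one_mul]
    have h := factorial_sum_le N
    rw [Fintype.card_fin] at h
    have h' : ((∑ k, N k).factorial : ℝ) ≤ (n : ℝ) ^ m * (∏ k, (N k).factorial : ℕ) := by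
      exact_mod_cast h
    refine h'.trans ?_
    gcongr
    linarith
  have hterm : ‖((∏ k, (α' k + β' k).choose (α' k) : ℕ) : ℂ) /
      (((2 * ħ : ℝ) : ℂ) ^ m * ((∏ k, (N k).factorial : ℕ) : ℂ))‖ ≤
      2 ^ g * (b ^ m * ((n + 1) ^ m / m.factorial)) := by
    rw [norm_div, norm_mul, norm_pow, Complex.norm_real, Real.norm_of_nonneg
      (by positivity), Complex.norm_natCast, Complex.norm_natCast, div_eq_mul_one_div,
      ← one_div_mul_one_div, ← one_div_pow]
    gcongr
    exact le_max_right _ _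
  -- comparison of factorials
  have hw : ((m + α'.degree).factorial : ℝ) ^ η * ((m + β'.degree).factorial : ℝ) ^ η ≤
      2 ^ (m + g) * (m.factorial * (g.factorial : ℝ) ^ (2 * η)) := by
    -- Both degrees have the form `m + d` with `d ≤ g`, since the remainders α' and β' add up to γ.
    have hle : ∀ d, d ≤ g → ((m + d).factorial : ℝ) ^ η ≤
        (2 ^ (m + g) * (m.factorial * (g.factorial : ℝ))) ^ η := by
      intro d hd
      refine Real.rpow_le_rpow (by positivity) ?_ h0
      have : (m + d).factorial ≤ 2 ^ (m + g) * (m.factorial * g.factorial) :=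
        (Nat.factorial_le (by omega)).trans (factorial_add_le m g)
      exact_mod_cast this
    refine (mul_le_mul (hle _ (by omega)) (hle _ (by omega)) (by positivity)
      (by positivity)).trans ?_
    rw [← Real.rpow_add (by positivity), ← two_mul, Real.mul_rpow (by positivity) (by positivity),
      Real.mul_rpow (by positivity) (by positivity)]
    gcongr
    · exact Real.rpow_le_self_of_one_le (one_le_pow₀ one_le_two) h1
    -- The restriction `2 * η ≤ 1` is decisive here: one full `m!` is all that the structure
    -- constant supplies in its denominator.
    · exact Real.rpow_le_self_of_one_le (by exact_mod_cast m.factorial_pos) h1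
  refine hterm.trans ?_
  rw [Real.rpow_neg (by positivity), Real.rpow_neg (by positivity)]
  have hpα : 0 < ((m + α'.degree).factorial : ℝ) ^ η := by positivity
  have hpβ : 0 < ((m + β'.degree).factorial : ℝ) ^ η := by positivity
  have hm : 0 < (m.factorial : ℝ) := by positivity
  have hR : c ^ (m + α'.degree) * (((m + α'.degree).factorial : ℝ) ^ η)⁻¹ *
      (c ^ (m + β'.degree) * (((m + β'.degree).factorial : ℝ) ^ η)⁻¹ *
      (c ^ g * (g.factorial : ℝ) ^ (2 * η))) =
      (c ^ (m + α'.degree) * c ^ (m + β'.degree) * c ^ g * (g.factorial : ℝ) ^ (2 * η)) /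
      (((m + α'.degree).factorial : ℝ) ^ η * ((m + β'.degree).factorial : ℝ) ^ η) := by
    field_simp
  rw [hR, le_div_iff₀ (by positivity)]
  calc _ ≤ 2 ^ g * (b ^ m * ((n + 1) ^ m / m.factorial)) *
        (2 ^ (m + g) * (m.factorial * (g.factorial : ℝ) ^ (2 * η))) := by gcongr
    _ = (2 * (b * (n + 1))) ^ m * 1 * 4 ^ g * (g.factorial : ℝ) ^ (2 * η) := by
        rw [show (4 : ℝ) = 2 * 2 by norm_num, mul_pow, mul_pow, mul_pow, pow_add]
        field_simp
    _ ≤ _ := by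
        gcongr
        · exact (pow_le_pow_left₀ (by positivity) hcb _).trans
            (pow_le_pow_right₀ hc1 (Nat.le_add_right _ _))
        · exact one_le_pow₀ hc1

end StructureConst

/-! ### The recursively defined seminorms -/

section Rec

variable {ι : Type*} (K : ι → ι → ι → ℂ)

/-- The weight of the summand of index `α` in the recursive definition of `h_{m+1,ℓ,γ}`. -/
def recWeight (l : ℕ) (γ α : ι) : ℝ≥0∞ :=
  if Even l then ∑' β, ‖K α β γ‖ₑ else ∑' β, ‖K β α γ‖ₑ

theorem recH_succ (a : ι → ℂ) (m l : ℕ) (γ : ι) :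
    recH K a (m + 1) l γ = ∑' α, recH K a m (l / 2) α ^ 2 * recWeight K l γ α := by
  rw [recH]
  unfold recWeight
  split_ifs <;> rfl

theorem recH_smul (c : ℂ) (a : ι → ℂ) (m l : ℕ) (γ : ι) :
    recH K (c • a) m l γ = ‖c‖ₑ ^ (2 ^ m) * recH K a m l γ := by
  induction m generalizing l γ with
  | zero => simp [recH, enorm_mul]
  | succ m ih =>
    rw [recH_succ, recH_succ, ← ENNReal.tsum_mul_left]
    refine tsum_congr fun α => ?_
    rw [ih, mul_pow, ← pow_mul, ← pow_succ, mul_assoc]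

/-- Minkowski's inequality on finite sets, with the weight absorbed into the functions as `w ^ (1 /
p)`. -/
theorem ENNReal.tsum_Lp_add_le (f g w : ι → ℝ≥0∞) {p : ℝ} (hp : 1 ≤ p) :
    (∑' i, (f i + g i) ^ p * w i) ^ (1 / p) ≤
      (∑' i, f i ^ p * w i) ^ (1 / p) + (∑' i, g i ^ p * w i) ^ (1 / p) := by
  have hp0 : 0 < p := by linarith
  have hw : ∀ (h : ι → ℝ≥0∞) i, h i ^ p * w i = (h i * w i ^ (1 / p)) ^ p := fun h i => by
    rw [ENNReal.mul_rpow_of_nonneg _ _ hp0.le, ← ENNReal.rpow_mul, one_div_mul_cancel hp0.ne',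
      ENNReal.rpow_one]
  rw [one_div, ENNReal.rpow_inv_le_iff hp0, ← one_div]
  refine ENNReal.summable.tsum_le_of_sum_le fun s => ?_
  rw [← ENNReal.rpow_inv_le_iff hp0, ← one_div]
  have h := ENNReal.Lp_add_le s (fun i => f i * w i ^ (1 / p)) (fun i => g i * w i ^ (1 / p)) hp
  simp only [← add_mul, ← hw] at h
  have h2 : ∀ i, (f i + g i) ^ p * w i = ((f i + g i) * w i ^ (1 / p)) ^ p :=
    hw fun i => f i + g i
  simp only [← h2] at h
  refine h.trans ?_
  gcongr <;> exact ENNReal.sum_le_tsum s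

/-- Level m + 1 is a weighted ℓ^p norm, with $p=2^{m+1}$, of the family of level-m seminorms, so the
triangle inequality propagates by Minkowski. -/
theorem recH_add_le (a b : ι → ℂ) (m l : ℕ) (γ : ι) :
    recH K (a + b) m l γ ^ ((1 : ℝ) / 2 ^ m) ≤
      recH K a m l γ ^ ((1 : ℝ) / 2 ^ m) + recH K b m l γ ^ ((1 : ℝ) / 2 ^ m) := by
  induction m generalizing l γ with
  | zero => simpa [recH] using enorm_add_le (a γ) (b γ)
  | succ m ih =>
    have hsq : ∀ x : ℝ≥0∞, x ^ 2 = (x ^ ((1 : ℝ) / 2 ^ m)) ^ ((2 : ℝ) ^ (m + 1)) := fun x => by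
      rw [← ENNReal.rpow_mul, ← ENNReal.rpow_natCast]
      congr 1
      rw [pow_succ]
      field_simp
      norm_num
    simp only [recH_succ, hsq]
    refine le_trans ?_ (ENNReal.tsum_Lp_add_le _ _ _ (one_le_pow₀ one_le_two))
    gcongr
    exact ih _ _

variable {K}

theorem recH_ge_of_even (a : ι → ℂ) (m : ℕ) {l : ℕ} (hl : Even l) (α β γ : ι) :
    recH K a m (l / 2) α ^ 2 * ‖K α β γ‖ₑ ≤ recH K a (m + 1) l γ := by
  rw [recH_succ]
  refine le_trans ?_ (ENNReal.le_tsum α)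
  rw [recWeight, if_pos hl]
  gcongr
  exact ENNReal.le_tsum β

theorem recH_ge_of_odd (a : ι → ℂ) (m : ℕ) {l : ℕ} (hl : ¬ Even l) (α β γ : ι) :
    recH K a m (l / 2) α ^ 2 * ‖K β α γ‖ₑ ≤ recH K a (m + 1) l γ := by
  rw [recH_succ]
  refine le_trans ?_ (ENNReal.le_tsum α)
  rw [recWeight, if_neg hl]
  gcongr
  exact ENNReal.le_tsum (f := fun β => ‖K β α γ‖ₑ) β

/-- Idling: at each level only the summand that stays at the index `α` is kept, with a structure
constant of modulus at least 1. -/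
theorem enorm_pow_le_recH (h1 : ∀ γ, ∃ β, 1 ≤ ‖K γ β γ‖ₑ) (h2 : ∀ γ, ∃ β, 1 ≤ ‖K β γ γ‖ₑ)
    (a : ι → ℂ) (m l : ℕ) (α : ι) : ‖a α‖ₑ ^ (2 ^ m) ≤ recH K a m l α := by
  induction m generalizing l with
  | zero => simp [recH]
  | succ m ih =>
    rw [pow_succ 2 m, pow_mul]
    by_cases hl : Even l
    · obtain ⟨β, hβ⟩ := h1 α
      refine le_trans ?_ (recH_ge_of_even a m hl α β α)
      rw [← mul_one (_ ^ 2)]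
      gcongr
      exact ih _
    · obtain ⟨β, hβ⟩ := h2 α
      refine le_trans ?_ (recH_ge_of_odd a m hl α β α)
      rw [← mul_one (_ ^ 2)]
      gcongr
      exact ih _

/-- After idling for `m` steps, an even step leads from α to μ and an odd step from μ to γ; in
binary this is ℓ = 1. The first factor `D` is squared by the second step, whence `D ^ 3`
independently of `m`. -/
theorem enorm_pow_le_mul_recH (h1 : ∀ γ, ∃ β, 1 ≤ ‖K γ β γ‖ₑ) (h2 : ∀ γ, ∃ β, 1 ≤ ‖K β γ γ‖ₑ)
    {D : ℝ≥0∞} {α β μ α' γ : ι} (h3 : 1 ≤ D * ‖K α β μ‖ₑ) (h4 : 1 ≤ D * ‖K α' μ γ‖ₑ)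
    (a : ι → ℂ) (m : ℕ) : ‖a α‖ₑ ^ (2 ^ (m + 2)) ≤ D ^ 3 * recH K a (m + 2) 1 γ := by
  have hX := enorm_pow_le_recH h1 h2 a m 0 α
  set X := ‖a α‖ₑ ^ (2 ^ m)
  have hY : X ^ 2 ≤ D * recH K a (m + 1) 0 μ := by
    calc X ^ 2 ≤ X ^ 2 * (D * ‖K α β μ‖ₑ) := le_mul_of_one_le_right' h3
      _ ≤ recH K a m 0 α ^ 2 * (D * ‖K α β μ‖ₑ) := by gcongr
      _ = D * (recH K a m (0 / 2) α ^ 2 * ‖K α β μ‖ₑ) := by rw [Nat.zero_div]; ring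
      _ ≤ _ := by gcongr; exact recH_ge_of_even a m Even.zero α β μ
  calc ‖a α‖ₑ ^ (2 ^ (m + 2)) = (X ^ 2) ^ 2 := by
        rw [← pow_mul, ← pow_mul]; congr 1; ring
    _ ≤ (D * recH K a (m + 1) 0 μ) ^ 2 := by gcongr
    _ ≤ (D * recH K a (m + 1) 0 μ) ^ 2 * (D * ‖K α' μ γ‖ₑ) := le_mul_of_one_le_right' h4
    _ = D ^ 3 * (recH K a (m + 1) (1 / 2) μ ^ 2 * ‖K α' μ γ‖ₑ) := by norm_num; ring
    _ ≤ _ := by gcongr; exact recH_ge_of_odd a (m + 1) (by decide) μ α' γ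

end Rec

/-! ### Upper bound for the recursion by coefficient growth -/

section RecBound

variable {σ : Type*} [Finite σ] {K : (σ →₀ ℕ) → (σ →₀ ℕ) → (σ →₀ ℕ) → ℂ}

theorem tsum_ofReal_pow_mul_factorial_rpow_ne_top {c δ : ℝ} (hc : 0 ≤ c) (hδ : 0 < δ) :
    ∑' N : σ →₀ ℕ, ENNReal.ofReal (c ^ N.degree * (N.degree.factorial : ℝ) ^ (-δ)) ≠ ⊤ :=
  (summable_pow_mul_factorial_rpow hc hδ).tsum_ofReal_ne_top

/-- Because the bound on `K` separates α, β and γ, each level reduces to two convergent sums and a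
growth factor in γ. The small exponent δ is carried through the induction so that the square from
the previous level is still beaten by the decay in α. -/
theorem exists_recH_le (hK : ∃ c : ℝ, 1 ≤ c ∧ ∀ η : ℝ, 0 ≤ η → 2 * η ≤ 1 → ∀ α β γ : σ →₀ ℕ,
      ‖K α β γ‖ ≤ (c ^ α.degree * (α.degree.factorial : ℝ) ^ (-η)) *
        ((c ^ β.degree * (β.degree.factorial : ℝ) ^ (-η)) *
        (c ^ γ.degree * (γ.degree.factorial : ℝ) ^ (2 * η)))) (m : ℕ) {δ : ℝ} (hδ : 0 < δ) :
    ∃ ε ∈ Set.Ioo (0 : ℝ) 1, ∃ C : ℝ≥0∞, C ≠ ⊤ ∧ ∀ (l : ℕ) (γ : σ →₀ ℕ) (a : (σ →₀ ℕ) → ℂ)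
      (P : ℝ≥0∞), (∀ α, ‖a α‖ₑ ≤ P * ENNReal.ofReal ((α.degree.factorial : ℝ) ^ ε)) →
      recH K a m l γ ≤ C * P ^ (2 ^ m) * ENNReal.ofReal ((γ.degree.factorial : ℝ) ^ δ) := by
  obtain ⟨c, hc, hK⟩ := hK
  have hc0 : 0 ≤ c := by linarith
  induction m generalizing δ with
  | zero =>
    refine ⟨min δ (1 / 2), ⟨by positivity, (min_le_right _ _).trans_lt (by norm_num)⟩, 1,
      ENNReal.one_ne_top, fun l γ a P h => ?_⟩
    rw [recH, one_mul, pow_zero, pow_one]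
    refine (h γ).trans ?_
    gcongr
    · exact_mod_cast γ.degree.factorial_pos
    · exact min_le_left _ _
  | succ m ih =>
    -- Small enough that `2 * η ≤ 1` and that a power `δ - 2 * η > 0` of the factorial remains to
    -- absorb `c ^ |γ|`.
    set η : ℝ := min δ 1 / 4 with hη
    have hη0 : 0 < η := by positivity
    have hη1 : 2 * η ≤ 1 := by have := min_le_right δ 1; rw [hη]; linarith
    have hηδ : 0 < δ - 2 * η := by have := min_le_left δ 1; rw [hη]; linarith
    -- Squaring the previous level gives growth with exponent η/2, and the decay with exponent η
    -- leaves -η/2, which is summable.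
    obtain ⟨ε, hε, C, hC, h⟩ := ih (δ := η / 4) (by positivity)
    obtain ⟨B, hB, hBk⟩ := exists_pow_le_factorial_rpow hc0 hηδ
    let A : (σ →₀ ℕ) → ℝ := fun α => c ^ α.degree * (α.degree.factorial : ℝ) ^ (-η)
    let SA := ∑' α, ENNReal.ofReal (A α)
    let A' : (σ →₀ ℕ) → ℝ := fun α => c ^ α.degree * (α.degree.factorial : ℝ) ^ (-(η / 2))
    let SA' := ∑' α, ENNReal.ofReal (A' α)
    have hSA : SA ≠ ⊤ := tsum_ofReal_pow_mul_factorial_rpow_ne_top hc0 hη0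
    have hSA' : SA' ≠ ⊤ := tsum_ofReal_pow_mul_factorial_rpow_ne_top hc0 (by positivity)
    have hA : ∀ α, 0 ≤ A α := fun α => by positivity
    refine ⟨ε, hε, C ^ 2 * SA * SA' * ENNReal.ofReal B, by finiteness, fun l γ a P hP => ?_⟩
    let G : ℝ := c ^ γ.degree * (γ.degree.factorial : ℝ) ^ (2 * η)
    have hG0 : 0 ≤ G := by positivity
    have hG : G ≤ B * (γ.degree.factorial : ℝ) ^ δ := by
      calc G ≤ B * (γ.degree.factorial : ℝ) ^ (δ - 2 * η) *
            (γ.degree.factorial : ℝ) ^ (2 * η) := by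
            simp only [G]; gcongr; exact hBk _
        _ = _ := by rw [mul_assoc, ← Real.rpow_add (by positivity), sub_add_cancel]
    have hen : ∀ α β, ‖K α β γ‖ₑ ≤
        ENNReal.ofReal (A α) * (ENNReal.ofReal (A β) * ENNReal.ofReal G) := by
      intro α β
      rw [← ofReal_norm, ← ENNReal.ofReal_mul (hA _), ← ENNReal.ofReal_mul (hA _)]
      exact ENNReal.ofReal_le_ofReal (hK η hη0.le hη1 α β γ)
    have hW : ∀ α, recWeight K l γ α ≤ ENNReal.ofReal (A α) * (SA * ENNReal.ofReal G) := by
      intro α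
      rw [← ENNReal.tsum_mul_right, ← ENNReal.tsum_mul_left, recWeight]
      split_ifs
      · exact ENNReal.tsum_le_tsum fun β => hen α β
      · exact ENNReal.tsum_le_tsum fun β => (hen β α).trans_eq (mul_left_comm _ _ _)
    have hA' : ∀ α : σ →₀ ℕ, ENNReal.ofReal ((α.degree.factorial : ℝ) ^ (η / 4)) ^ 2 *
        ENNReal.ofReal (A α) = ENNReal.ofReal (A' α) := by
      intro α
      rw [← ENNReal.ofReal_pow (by positivity), ← ENNReal.ofReal_mul (by positivity)]
      congr 1
      simp only [A, A']
      rw [← Real.rpow_natCast, ← Real.rpow_mul (by positivity), mul_left_comm,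
        ← Real.rpow_add (by positivity)]
      congr 2
      push_cast
      ring
    calc recH K a (m + 1) l γ
        = ∑' α, recH K a m (l / 2) α ^ 2 * recWeight K l γ α := recH_succ ..
      _ ≤ ∑' α : σ →₀ ℕ,
          (C * P ^ (2 ^ m) * ENNReal.ofReal ((α.degree.factorial : ℝ) ^ (η / 4))) ^ 2 *
          (ENNReal.ofReal (A α) * (SA * ENNReal.ofReal G)) := by
          refine ENNReal.tsum_le_tsum fun α => ?_
          gcongr
          · exact h _ _ _ _ hP
          · exact hW α
      _ = ∑' α, (C ^ 2 * P ^ (2 ^ (m + 1)) * SA * ENNReal.ofReal G) * ENNReal.ofReal (A' α) := by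
          refine tsum_congr fun α => ?_
          rw [← hA', pow_succ 2 m, pow_mul]
          ring
      _ = (C ^ 2 * P ^ (2 ^ (m + 1)) * SA * ENNReal.ofReal G) * SA' := ENNReal.tsum_mul_left
      _ ≤ (C ^ 2 * P ^ (2 ^ (m + 1)) * SA * (ENNReal.ofReal B *
          ENNReal.ofReal ((γ.degree.factorial : ℝ) ^ δ))) * SA' := by
          rw [← ENNReal.ofReal_mul hB.le]
          gcongr
      _ = _ := by ring

end RecBound

/-! ### The Köthe space of sub-factorial growth -/

namespace KoetheSpace

variable {σ : Type*}

theorem summable (a : KoetheSpace σ) {ε : ℝ} (hε : ε ∈ Set.Ioo (0 : ℝ) 1) :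
    Summable fun N => ‖a.coeff N‖ / (N.degree.factorial : ℝ) ^ ε :=
  (show koetheSubmodule σ from a).2 ε hε

/-- The element of the Köthe space with given coefficients. -/
def mk (a : (σ →₀ ℕ) → ℂ) (h : ∀ ε ∈ Set.Ioo (0 : ℝ) 1,
    Summable fun N => ‖a N‖ / (N.degree.factorial : ℝ) ^ ε) : KoetheSpace σ :=
  (⟨a, h⟩ : koetheSubmodule σ)

@[ext] theorem ext {a b : KoetheSpace σ} (h : ∀ N, a.coeff N = b.coeff N) : a = b :=
  Subtype.ext (funext h)

@[simp] theorem coeff_add (a b : KoetheSpace σ) (N) : (a + b).coeff N = a.coeff N + b.coeff N :=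
  rfl
@[simp] theorem coeff_sub (a b : KoetheSpace σ) (N) : (a - b).coeff N = a.coeff N - b.coeff N :=
  rfl
@[simp] theorem coeff_smul (c : ℂ) (a : KoetheSpace σ) (N) : (c • a).coeff N = c * a.coeff N :=
  rfl

/-- The coefficient functional as a linear map. -/
def coeffₗ (N : σ →₀ ℕ) : KoetheSpace σ →ₗ[ℂ] ℂ where
  toFun a := a.coeff N
  map_add' _ _ := rfl
  map_smul' _ _ := rfl

theorem seminorm_apply (ε : Set.Ioo (0 : ℝ) 1) (a : KoetheSpace σ) :
    koetheSeminorm σ ε a = ∑' N, ‖a.coeff N‖ / (N.degree.factorial : ℝ) ^ (ε : ℝ) := rfl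

theorem withSeminorms : WithSeminorms (koetheSeminorm σ) := ⟨rfl⟩

instance : IsTopologicalAddGroup (KoetheSpace σ) := withSeminorms.topologicalAddGroup
instance : ContinuousSMul ℂ (KoetheSpace σ) := withSeminorms.continuousSMul
instance : UniformSpace (KoetheSpace σ) := IsTopologicalAddGroup.rightUniformSpace _
instance : IsUniformAddGroup (KoetheSpace σ) := isUniformAddGroup_of_addCommGroup

theorem norm_coeff_le (a : KoetheSpace σ) (ε : Set.Ioo (0 : ℝ) 1) (N : σ →₀ ℕ) :
    ‖a.coeff N‖ ≤ (N.degree.factorial : ℝ) ^ (ε : ℝ) * koetheSeminorm σ ε a := by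
  rw [← div_le_iff₀' (by positivity), seminorm_apply]
  exact (a.summable ε.2).le_tsum N fun _ _ => by positivity

theorem seminorm_anti {ε ε' : Set.Ioo (0 : ℝ) 1} (h : ε ≤ ε') :
    koetheSeminorm σ ε' ≤ koetheSeminorm σ ε := by
  intro a
  refine (a.summable ε'.2).tsum_le_tsum (fun N => ?_) (a.summable ε.2)
  gcongr
  exact_mod_cast N.degree.factorial_pos

/-- The seminorms grow as ε decreases, so the family is directed and one of them controls each
continuous seminorm. -/
theorem exists_finset_sup_le (s : Finset (Set.Ioo (0 : ℝ) 1)) :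
    ∃ ε, s.sup (koetheSeminorm σ) ≤ koetheSeminorm σ ε := by
  classical
  induction s using Finset.induction with
  | empty => exact ⟨Classical.arbitrary _, by simp⟩
  | insert ε s _ ih =>
    obtain ⟨ε', h⟩ := ih
    refine ⟨min ε ε', ?_⟩
    rw [Finset.sup_insert]
    exact sup_le (seminorm_anti (min_le_left _ _)) (h.trans (seminorm_anti (min_le_right _ _)))

theorem exists_le_of_continuous {p : Seminorm ℂ (KoetheSpace σ)} (hp : Continuous p) :
    ∃ (ε : Set.Ioo (0 : ℝ) 1) (C : ℝ), 0 < C ∧ ∀ a, p a ≤ C * koetheSeminorm σ ε a := by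
  obtain ⟨s, C, hC, h⟩ := Seminorm.bound_of_continuous withSeminorms p hp
  obtain ⟨ε, hε⟩ := exists_finset_sup_le (σ := σ) s
  refine ⟨ε, C, by positivity, fun a => (h a).trans ?_⟩
  rw [smul_apply, NNReal.smul_def, smul_eq_mul]
  gcongr
  exact hε a

theorem continuous_seminorm (ε : Set.Ioo (0 : ℝ) 1) : Continuous (koetheSeminorm σ ε) :=
  withSeminorms.continuous_seminorm ε

theorem continuous_coeff (N : σ →₀ ℕ) : Continuous (coeffₗ N) := by
  let ε : Set.Ioo (0 : ℝ) 1 := Classical.arbitrary _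
  refine continuous_of_continuousAt_zero (coeffₗ N) ?_
  rw [ContinuousAt, map_zero, tendsto_zero_iff_norm_tendsto_zero]
  have h : Tendsto (fun a : KoetheSpace σ =>
      (N.degree.factorial : ℝ) ^ (ε : ℝ) * koetheSeminorm σ ε a) (𝓝 0) (𝓝 0) := by
    have := ((continuous_seminorm (σ := σ) ε).const_mul
      ((N.degree.factorial : ℝ) ^ (ε : ℝ))).tendsto 0
    simpa using this
  exact squeeze_zero (fun _ => norm_nonneg _) (fun a => norm_coeff_le a ε N) h

/-- The coefficient functional as a continuous linear map. -/
def coeffL (N : σ →₀ ℕ) : KoetheSpace σ →L[ℂ] ℂ := ⟨coeffₗ N, continuous_coeff N⟩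

@[simp] theorem coeffL_apply (N : σ →₀ ℕ) (a : KoetheSpace σ) : coeffL N a = a.coeff N := rfl

instance : T2Space (KoetheSpace σ) := by
  have : T1Space (KoetheSpace σ) := by
    refine withSeminorms.T1_of_separating fun a ha => ⟨Classical.arbitrary _, fun h => ha ?_⟩
    ext N
    have := norm_coeff_le a (Classical.arbitrary _) N
    rw [h, mul_zero] at this
    exact norm_le_zero_iff.1 this
  infer_instance

/-- A countable family of seminorms of the Köthe space. -/
def countableFamily (σ : Type*) : SeminormFamily ℂ (KoetheSpace σ) ℕ := fun k =>
  koetheSeminorm σ ⟨1 / ((k : ℝ) + 2), by positivity, by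
    rw [div_lt_one (by positivity)]; have : (0 : ℝ) ≤ k := k.cast_nonneg; linarith⟩

/-- The exponents 1/(k + 2) lie below 1 for every k and tend to 0, hence are cofinal among the
seminorms. -/
theorem withSeminorms_countableFamily : WithSeminorms (countableFamily σ) := by
  refine withSeminorms.congr (fun k => ?_) (fun ε => ?_)
  · refine ⟨{⟨1 / ((k : ℝ) + 2), by positivity, by
      rw [div_lt_one (by positivity)]; have : (0 : ℝ) ≤ k := k.cast_nonneg; linarith⟩}, 1, ?_⟩
    simp only [Finset.sup_singleton, one_smul]
    exact le_rfl
  · obtain ⟨k, hk⟩ := exists_nat_one_div_lt ε.2.1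
    refine ⟨{k}, 1, ?_⟩
    simp only [Finset.sup_singleton, one_smul]
    refine seminorm_anti (Subtype.mk_le_mk.2 (le_trans ?_ hk.le))
    gcongr
    norm_num

/-- As for weighted ℓ¹: a Cauchy filter converges coordinatewise, and its estimates survive the
limit on finite sets of indices, uniformly in the set. -/
instance : CompleteSpace (KoetheSpace σ) := by
  refine ⟨fun {f} hf => ?_⟩
  have := hf.1
  have hlim : ∀ N : σ →₀ ℕ, ∃ x : ℂ, Tendsto (fun a : KoetheSpace σ => a.coeff N) f (𝓝 x) :=
    fun N => CompleteSpace.complete (hf.map (coeffL N).uniformContinuous)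
  choose x hx using hlim
  have hsmall : ∀ (ε : Set.Ioo (0 : ℝ) 1) {η : ℝ}, 0 < η →
      ∃ t ∈ f, ∀ a ∈ t, ∀ b ∈ t, koetheSeminorm σ ε (b - a) < η := by
    intro ε η hη
    have hU : {z | koetheSeminorm σ ε z < η} ∈ 𝓝 (0 : KoetheSpace σ) :=
      (isOpen_lt (continuous_seminorm ε) continuous_const).mem_nhds (by simpa using hη)
    have hV : {q : KoetheSpace σ × KoetheSpace σ | koetheSeminorm σ ε (q.2 - q.1) < η} ∈
        uniformity (KoetheSpace σ) := by
      rw [uniformity_eq_comap_nhds_zero]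
      exact ⟨_, hU, fun _ h => h⟩
    obtain ⟨t, ht, h⟩ := (cauchy_iff.1 hf).2 _ hV
    exact ⟨t, ht, fun a ha b hb => h (Set.mk_mem_prod ha hb)⟩
  have hsum : ∀ (ε : Set.Ioo (0 : ℝ) 1) {η : ℝ}, 0 < η → ∃ t ∈ f, ∀ a ∈ t, ∀ s : Finset (σ →₀ ℕ),
      ∑ N ∈ s, ‖x N - a.coeff N‖ / (N.degree.factorial : ℝ) ^ (ε : ℝ) ≤ η := by
    intro ε η hη
    obtain ⟨t, ht, h⟩ := hsmall ε hη
    refine ⟨t, ht, fun a ha s => ?_⟩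
    have hl : Tendsto (fun b : KoetheSpace σ =>
        ∑ N ∈ s, ‖b.coeff N - a.coeff N‖ / (N.degree.factorial : ℝ) ^ (ε : ℝ)) f
        (𝓝 (∑ N ∈ s, ‖x N - a.coeff N‖ / (N.degree.factorial : ℝ) ^ (ε : ℝ))) :=
      tendsto_finsetSum _ fun N _ => (((hx N).sub_const _).norm).div_const _
    refine le_of_tendsto hl ?_
    filter_upwards [ht] with b hb
    refine le_trans ?_ (h a ha b hb).le
    rw [seminorm_apply]
    exact ((b - a).summable ε.2).sum_le_tsum s fun _ _ => by positivity
  have hxs : ∀ ε ∈ Set.Ioo (0 : ℝ) 1,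
      Summable fun N => ‖x N‖ / (N.degree.factorial : ℝ) ^ ε := by
    intro ε hε
    obtain ⟨t, ht, h⟩ := hsum ⟨ε, hε⟩ one_pos
    obtain ⟨a, ha⟩ := nonempty_of_mem ht
    have h1 : Summable fun N => ‖x N - a.coeff N‖ / (N.degree.factorial : ℝ) ^ ε :=
      summable_of_sum_le (fun _ => by positivity) (h a ha)
    refine Summable.of_nonneg_of_le (fun _ => by positivity) (fun N => ?_) (h1.add (a.summable hε))
    rw [← add_div]
    gcongr
    simpa using norm_add_le (x N - a.coeff N) (a.coeff N)
  refine ⟨mk x hxs, ?_⟩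
  change Tendsto id f (𝓝 _)
  rw [withSeminorms.tendsto_nhds]
  intro ε η hη
  obtain ⟨t, ht, h⟩ := hsum ε (half_pos hη)
  filter_upwards [ht] with a ha
  refine lt_of_le_of_lt ?_ (half_lt_self hη)
  rw [id, ← map_neg_eq_map, neg_sub, seminorm_apply]
  exact Real.tsum_le_of_sum_le (fun _ => by positivity) (h a ha)

/-- Finitely supported families as elements of the Köthe space. -/
def ofFinsupp : ((σ →₀ ℕ) →₀ ℂ) →ₗ[ℂ] KoetheSpace σ where
  toFun a := mk a fun ε _ => summable_of_hasFiniteSupport <|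
    a.hasFiniteSupport.subset fun N hN h => hN (by simp [h])
  map_add' _ _ := rfl
  map_smul' _ _ := rfl

@[simp] theorem coeff_ofFinsupp (a : (σ →₀ ℕ) →₀ ℂ) (N : σ →₀ ℕ) :
    (ofFinsupp a).coeff N = a N := rfl

theorem seminorm_ofFinsupp_single (ε : Set.Ioo (0 : ℝ) 1) (N : σ →₀ ℕ) :
    koetheSeminorm σ ε (ofFinsupp (Finsupp.single N 1)) =
      ((N.degree.factorial : ℝ) ^ (ε : ℝ))⁻¹ := by
  rw [seminorm_apply, tsum_eq_single N]
  · simp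
  · intro M hM
    simp [hM.symm]

theorem hasSum_coeff (a : KoetheSpace σ) :
    HasSum (fun N => a.coeff N • ofFinsupp (Finsupp.single N 1)) a := by
  classical
  rw [HasSum, withSeminorms.tendsto_nhds]
  intro ε η hη
  filter_upwards [(tendsto_order.1 (tendsto_tsum_compl_atTop_zero fun N : σ →₀ ℕ =>
    ‖a.coeff N‖ / (N.degree.factorial : ℝ) ^ (ε : ℝ))).2 η hη] with s hs
  refine lt_of_le_of_lt (le_of_eq ?_) hs
  have hc : ∀ M, (∑ N ∈ s, a.coeff N • ofFinsupp (Finsupp.single N 1) - a).coeff M =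
      if M ∈ s then 0 else - a.coeff M := by
    intro M
    rw [coeff_sub, ← coeffL_apply, map_sum]
    simp only [coeffL_apply, coeff_smul, coeff_ofFinsupp, Finsupp.single_apply]
    simp
    split_ifs <;> simp
  rw [seminorm_apply]
  have := tsum_subtype ({N | N ∉ s} : Set (σ →₀ ℕ)) fun N : σ →₀ ℕ =>
    ‖a.coeff N‖ / (N.degree.factorial : ℝ) ^ (ε : ℝ)
  refine Eq.trans (tsum_congr fun M => ?_) this.symm
  rw [hc]
  by_cases hM : M ∈ s <;> simp [hM]

theorem denseRange_ofFinsupp : DenseRange (ofFinsupp (σ := σ)) := by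
  intro a
  refine mem_closure_of_tendsto (hasSum_coeff a) (Eventually.of_forall fun s => ?_)
  simp only [← map_smul, ← map_sum]
  exact Set.mem_range_self _

-- Absoluteness is built into the seminorms: `p ≤ C p_ε` bounds `p` on the basis vector of index N
-- by $C(|N|!)^{-\epsilon}$, and the resulting sum is at most $C\,p_\epsilon$.
open scoped Classical in
theorem isAbsoluteSchauderBasis : IsAbsoluteSchauderBasis
    (fun N : σ →₀ ℕ => ofFinsupp (Finsupp.single N 1)) coeffL where
  biorthogonal k l := by
    rw [coeffL_apply, coeff_ofFinsupp, Finsupp.single_apply]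
    congr 1
    exact propext eq_comm
  hasSum := hasSum_coeff
  absolute p hp := by
    obtain ⟨ε, C, hC, h⟩ := exists_le_of_continuous hp
    lift C to NNReal using hC.le
    refine ⟨C • koetheSeminorm σ ε, (continuous_seminorm ε).const_smul C, fun a => ?_⟩
    have hle : ∀ N, ‖coeffL N a‖ * p (ofFinsupp (Finsupp.single N 1)) ≤
        C * (‖a.coeff N‖ / (N.degree.factorial : ℝ) ^ (ε : ℝ)) := by
      intro N
      have := h (ofFinsupp (Finsupp.single N 1))
      rw [seminorm_ofFinsupp_single] at this
      rw [coeffL_apply]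
      calc _ ≤ ‖a.coeff N‖ * (C * ((N.degree.factorial : ℝ) ^ (ε : ℝ))⁻¹) := by gcongr
        _ = _ := by rw [div_eq_mul_inv]; ring
    have hs : Summable fun N => ‖coeffL N a‖ * p (ofFinsupp (Finsupp.single N 1)) :=
      Summable.of_nonneg_of_le (fun N => mul_nonneg (norm_nonneg _) (apply_nonneg _ _)) hle
        ((a.summable ε.2).mul_left (C : ℝ))
    refine ⟨hs, (hs.tsum_le_tsum hle ((a.summable ε.2).mul_left (C : ℝ))).trans_eq ?_⟩
    rw [tsum_mul_left]
    rfl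

/-- The expansion is the basis expansion, with the weight $(|N|!)^{-\epsilon}$ split in half. One
half makes the coefficient functional bounded by $p_{\epsilon/2}$, the other becomes λ, which is
r-summable for all r > 0; the basis vectors are rescaled to be bounded for `p`. -/
theorem isStronglyNuclear [Finite σ] : IsStronglyNuclear (KoetheSpace σ) := by
  intro p hp
  obtain ⟨ε, C, hC, h⟩ := exists_le_of_continuous hp
  let _ : Encodable (σ →₀ ℕ) := Encodable.ofCountable _
  have hε := ε.2.1
  let ε' : Set.Ioo (0 : ℝ) 1 := ⟨ε / 2, by positivity, by linarith [ε.2.2]⟩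
  have hw : ∀ (N : σ →₀ ℕ) (r : ℝ), 0 < (N.degree.factorial : ℝ) ^ r := fun N r => by positivity
  let lam : (σ →₀ ℕ) → ℝ := fun N => C * (N.degree.factorial : ℝ) ^ (-(ε / 2 : ℝ))
  let f : (σ →₀ ℕ) → KoetheSpace σ →L[ℂ] ℂ := fun N =>
    (((N.degree.factorial : ℝ) ^ (-(ε / 2 : ℝ)) : ℝ) : ℂ) • coeffL N
  let y : (σ →₀ ℕ) → KoetheSpace σ := fun N =>
    ((C⁻¹ * (N.degree.factorial : ℝ) ^ (ε : ℝ) : ℝ) : ℂ) • ofFinsupp (Finsupp.single N 1)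
  have hinj : Function.Injective (Encodable.encode : (σ →₀ ℕ) → ℕ) := Encodable.encode_injective
  have hterm : ∀ a N, ((lam N : ℂ) * f N a) • y N =
      a.coeff N • ofFinsupp (Finsupp.single N 1) := by
    intro a N
    simp only [lam, f, y, smul_apply, coeffL_apply, smul_smul, smul_eq_mul]
    congr 1
    have : C * (N.degree.factorial : ℝ) ^ (-(ε / 2 : ℝ)) *
        (N.degree.factorial : ℝ) ^ (-(ε / 2 : ℝ)) *
        (C⁻¹ * (N.degree.factorial : ℝ) ^ (ε : ℝ)) = 1 := by
      have h1 : (N.degree.factorial : ℝ) ^ (-(ε / 2 : ℝ)) *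
          (N.degree.factorial : ℝ) ^ (-(ε / 2 : ℝ)) * (N.degree.factorial : ℝ) ^ (ε : ℝ) = 1 := by
        rw [← Real.rpow_add (by positivity), ← Real.rpow_add (by positivity)]
        ring_nf
        simp
      calc _ = C * C⁻¹ * ((N.degree.factorial : ℝ) ^ (-(ε / 2 : ℝ)) *
          (N.degree.factorial : ℝ) ^ (-(ε / 2 : ℝ)) * (N.degree.factorial : ℝ) ^ (ε : ℝ)) := by
            ring
        _ = 1 := by rw [h1, mul_inv_cancel₀ hC.ne', mul_one]
    have h2 := congrArg (fun r : ℝ => (r : ℂ) * a.coeff N) this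
    simp only [Complex.ofReal_mul, Complex.ofReal_one, one_mul] at h2
    refine Eq.trans ?_ h2
    push_cast
    ring
  -- Multiindices are enumerated by an encoding that need not be surjective; unused natural numbers
  -- receive zero terms.
  refine ⟨koetheSeminorm σ ε', continuous_seminorm ε',
    Function.extend Encodable.encode lam 0, Function.extend Encodable.encode f 0,
    Function.extend Encodable.encode y 0, fun r hr => ?_, fun k a => ?_, fun k => ?_, fun a => ?_⟩
  · have hs : Summable fun N : σ →₀ ℕ => |lam N| ^ r := by
      refine ((summable_pow_mul_factorial_rpow (σ := σ) (c := 1) (δ := ε / 2 * r) zero_le_one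
        (by positivity)).mul_left (C ^ r)).congr fun N => ?_
      simp only [lam]
      rw [abs_of_nonneg (by positivity), Real.mul_rpow hC.le (hw _ _).le, one_pow, one_mul,
        ← Real.rpow_mul (by positivity), neg_mul]
    rw [← hinj.summable_iff]
    · refine hs.congr fun N => ?_
      simp [hinj.extend_apply]
    · intro k hk
      rw [Function.extend_apply' _ _ _ fun ⟨N, hN⟩ => hk ⟨N, hN⟩]
      simp [Real.zero_rpow hr.ne']
  · by_cases hk : ∃ N : σ →₀ ℕ, Encodable.encode N = k
    · obtain ⟨N, rfl⟩ := hk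
      rw [hinj.extend_apply]
      simp only [f, smul_apply, coeffL_apply, norm_smul, Complex.norm_real]
      rw [Real.norm_of_nonneg (by positivity), Real.rpow_neg (by positivity),
        inv_mul_le_iff₀ (by positivity)]
      exact norm_coeff_le a ε' N
    · rw [Function.extend_apply' _ _ _ hk]
      simp
  · by_cases hk : ∃ N : σ →₀ ℕ, Encodable.encode N = k
    · obtain ⟨N, rfl⟩ := hk
      rw [hinj.extend_apply]
      simp only [y]
      rw [map_smul_eq_mul, Complex.norm_real, Real.norm_of_nonneg (by positivity)]
      have := h (ofFinsupp (Finsupp.single N 1))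
      rw [seminorm_ofFinsupp_single] at this
      calc _ ≤ C⁻¹ * (N.degree.factorial : ℝ) ^ (ε : ℝ) *
            (C * ((N.degree.factorial : ℝ) ^ (ε : ℝ))⁻¹) := by gcongr
        _ = 1 := by have := hw N ε; field_simp
    · rw [Function.extend_apply' _ _ _ hk]
      simp
  · have hs : HasSum (fun k => (((Function.extend Encodable.encode lam 0 k : ℝ) : ℂ) *
        Function.extend Encodable.encode f 0 k a) • Function.extend Encodable.encode y 0 k) a := by
      have h0 := hasSum_coeff a
      rw [← hasSum_extend_zero hinj] at h0
      convert h0 using 1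
      funext k
      by_cases hk : ∃ N : σ →₀ ℕ, Encodable.encode N = k
      · obtain ⟨N, rfl⟩ := hk
        simp only [hinj.extend_apply]
        exact hterm a N
      · simp only [Function.extend_apply' _ _ _ hk]
        simp
    have ht := (hs.tendsto_sum_nat.const_sub a)
    rw [sub_self] at ht
    have := (hp.tendsto 0).comp ht
    rwa [map_zero] at this

end KoetheSpace

/-! ### The locally convex topology of the Weyl algebra -/

/-- Balls about every centre are generators, so finite intersections of those centred at a point
contain all basic neighbourhoods; conversely each ball is open by continuity of its seminorm. -/
theorem generateFrom_seminorm_balls_eq {A J : Type*} [AddCommGroup A] [Module ℂ A] [Nonempty J]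
    (p : SeminormFamily ℂ A J) :
    TopologicalSpace.generateFrom {U | ∃ (i : J) (a₀ : A) (r : ℝ≥0∞),
      U = {a | ENNReal.ofReal (p i (a - a₀)) < r}} = p.moduleFilterBasis.topology := by
  have hp : @WithSeminorms ℂ A J _ _ _ p p.moduleFilterBasis.topology :=
    @WithSeminorms.mk _ _ _ _ _ _ _ p.moduleFilterBasis.topology rfl
  have hmem : ∀ (t : TopologicalSpace A) (U : Set A) (x : A), IsOpen U → x ∈ U → U ∈ 𝓝 x :=
    fun t U x h1 h2 => h1.mem_nhds h2
  refine le_antisymm (le_of_nhds_le_nhds fun x => ?_) (le_generateFrom ?_)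
  · have hb := @WithSeminorms.hasBasis_ball _ _ _ _ _ _ p.moduleFilterBasis.topology p hp x
    rw [hb.ge_iff]
    rintro ⟨s, r⟩ hr
    simp only at hr ⊢
    rw [Seminorm.ball_finset_sup_eq_iInter _ _ _ hr, Finset.iInter_mem_sets]
    intro i _
    refine hmem _ _ _ (TopologicalSpace.isOpen_generateFrom_of_mem
      ⟨i, x, ENNReal.ofReal r, ?_⟩) (Seminorm.mem_ball_self _ hr)
    ext a
    simp [Seminorm.mem_ball, ENNReal.ofReal_lt_ofReal_iff hr]
  · rintro _ ⟨i, a₀, r, rfl⟩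
    let _ := p.moduleFilterBasis.topology
    have := hp.topologicalAddGroup
    have hc := hp.continuous_seminorm i
    exact isOpen_lt (ENNReal.continuous_ofReal.comp (hc.comp (continuous_id.sub continuous_const)))
      continuous_const

section Wick

variable {n : ℕ} {ħ : ℝ} (hħ : 0 < ħ)

/-- The coefficients of an element of the Weyl algebra as an element of the Köthe space. -/
def wickCoeff : WickAlgebra n hħ →ₗ[ℂ] KoetheSpace (Fin n ⊕ Fin n) :=
  KoetheSpace.ofFinsupp ∘ₗ (wickBasis n hħ).repr.toLinearMap

theorem coeff_wickCoeff (f : WickAlgebra n hħ) (N : WickIndex n) :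
    (wickCoeff hħ f).coeff N = (wickBasis n hħ).repr f N := rfl

theorem wickCoeff_wickBasis (N : WickIndex n) :
    wickCoeff hħ (wickBasis n hħ N) = KoetheSpace.ofFinsupp (Finsupp.single N 1) := by
  rw [wickCoeff, LinearMap.comp_apply, LinearEquiv.coe_coe, Module.Basis.repr_self]

theorem exists_recNorm_le (m : ℕ) (γ : WickIndex n) :
    ∃ (ε : Set.Ioo (0 : ℝ) 1) (C : NNReal), ∀ l f,
      recNorm (wickBasis n hħ) (wickStar hħ) m l γ f ≤
        ENNReal.ofReal (C * koetheSeminorm _ ε (wickCoeff hħ f)) := by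
  -- As γ is fixed, its factorial is a mere constant, and δ = 1 is as good as any other exponent.
  obtain ⟨ε, hε, C, hC, h⟩ := exists_recH_le (exists_norm_structureConst_le n hħ) m one_pos
  have hD : (C * ENNReal.ofReal ((γ.degree.factorial : ℝ) ^ (1 : ℝ))) ^ ((1 : ℝ) / 2 ^ m) ≠ ⊤ :=
    ENNReal.rpow_ne_top_of_nonneg (by positivity) (by finiteness)
  refine ⟨⟨ε, hε⟩, ((C * ENNReal.ofReal ((γ.degree.factorial : ℝ) ^ (1 : ℝ))) ^
    ((1 : ℝ) / 2 ^ m)).toNNReal, fun l f => ?_⟩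
  have hP : ∀ α, ‖(wickBasis n hħ).repr f α‖ₑ ≤
      ENNReal.ofReal (koetheSeminorm _ ⟨ε, hε⟩ (wickCoeff hħ f)) *
        ENNReal.ofReal ((α.degree.factorial : ℝ) ^ ε) := fun α => by
    rw [← ENNReal.ofReal_mul (apply_nonneg _ _), ← ofReal_norm]
    refine ENNReal.ofReal_le_ofReal ?_
    rw [mul_comm]
    exact KoetheSpace.norm_coeff_le (wickCoeff hħ f) ⟨ε, hε⟩ α
  refine (ENNReal.rpow_le_rpow (h l γ _ _ hP) (by positivity)).trans_eq ?_
  rw [ENNReal.ofReal_mul (NNReal.coe_nonneg _), ENNReal.ofReal_coe_nnreal, ENNReal.coe_toNNReal hD,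
    mul_right_comm, ENNReal.mul_rpow_of_nonneg _ _ (by positivity)]
  congr 1
  rw [← ENNReal.rpow_natCast, ← ENNReal.rpow_mul]
  simp

theorem recNorm_ne_top (m l : ℕ) (γ : WickIndex n) (f : WickAlgebra n hħ) :
    recNorm (wickBasis n hħ) (wickStar hħ) m l γ f ≠ ⊤ := by
  obtain ⟨ε, C, h⟩ := exists_recNorm_le hħ m γ
  exact ne_top_of_le_ne_top ENNReal.ofReal_ne_top (h l f)

/-- The seminorms `‖·‖_{m,ℓ,γ}` on the Weyl algebra. -/
def wickSeminorm : SeminormFamily ℂ (WickAlgebra n hħ) ((m : ℕ) × Fin (2 ^ m) × WickIndex n) :=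
  fun i => Seminorm.of
    (fun f => (recNorm (wickBasis n hħ) (wickStar hħ) i.1 i.2.1 i.2.2 f).toReal)
    (fun f g => by
      rw [← ENNReal.toReal_add (recNorm_ne_top hħ _ _ _ _) (recNorm_ne_top hħ _ _ _ _)]
      refine ENNReal.toReal_mono (ENNReal.add_ne_top.2 ⟨recNorm_ne_top hħ _ _ _ _, recNorm_ne_top hħ _ _ _ _⟩) ?_
      have := recH_add_le (structureConst (wickBasis n hħ) (wickStar hħ))
        ((wickBasis n hħ).repr f) ((wickBasis n hħ).repr g) i.1 i.2.1 i.2.2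
      rwa [← Finsupp.coe_add, ← map_add] at this)
    (fun c f => by
      have := recH_smul (structureConst (wickBasis n hħ) (wickStar hħ)) c
        ((wickBasis n hħ).repr f) i.1 i.2.1 i.2.2
      rw [← Finsupp.coe_smul, ← map_smul] at this
      simp only [recNorm]
      rw [this, ENNReal.mul_rpow_of_nonneg _ _ (by positivity), ENNReal.toReal_mul,
        ← ENNReal.rpow_natCast, ← ENNReal.rpow_mul]
      simp)

theorem ofReal_wickSeminorm (m : ℕ) (l : Fin (2 ^ m)) (γ : WickIndex n) (f : WickAlgebra n hħ) :
    ENNReal.ofReal (wickSeminorm hħ ⟨m, l, γ⟩ f) =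
      recNorm (wickBasis n hħ) (wickStar hħ) m l γ f :=
  ENNReal.ofReal_toReal (recNorm_ne_top hħ _ _ _ _)

instance (n : ℕ) : Nonempty ((m : ℕ) × Fin (2 ^ m) × WickIndex n) := ⟨⟨0, ⟨0, by simp⟩, 0⟩⟩

theorem withSeminorms_wickSeminorm : WithSeminorms (wickSeminorm (n := n) hħ) := by
  constructor
  rw [← generateFrom_seminorm_balls_eq]
  change TopologicalSpace.generateFrom _ = _
  congr 1
  ext U
  constructor
  · rintro ⟨m, l, γ, a₀, r, hl, rfl⟩
    exact ⟨⟨m, ⟨l, hl⟩, γ⟩, a₀, r, by simp only [ofReal_wickSeminorm]⟩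
  · rintro ⟨⟨m, l, γ⟩, a₀, r, rfl⟩
    exact ⟨m, l, γ, a₀, r, l.2, by simp only [ofReal_wickSeminorm]⟩

/-- One recursive seminorm, of index (m + 2, 1, 0), suffices: it bounds each coefficient up to
$(c^{|\alpha|}|\alpha|!)^{\theta}$. -/
theorem exists_koetheSeminorm_wickCoeff_le (ε : Set.Ioo (0 : ℝ) 1) :
    ∃ i, ∃ C : NNReal, ∀ f : WickAlgebra n hħ,
      koetheSeminorm _ ε (wickCoeff hħ f) ≤ C * wickSeminorm hħ i f := by
  obtain ⟨c, hc, h⟩ := exists_one_le_norm_structureConst n hħ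
  have hε := ε.2.1
  have hc0 : 0 ≤ c := by linarith
  -- The 3 is the exponent of `D` in the two-step estimate. With θ ≤ ε/2, half of the Köthe weight
  -- is left for summation over α.
  obtain ⟨m, hm⟩ : ∃ m : ℕ, 3 * ((1 : ℝ) / 2 ^ (m + 2)) ≤ ε / 2 := by
    obtain ⟨m, hm⟩ := exists_pow_lt_of_lt_one (show (0 : ℝ) < ε / 6 by positivity)
      (show (1 / 2 : ℝ) < 1 by norm_num)
    refine ⟨m, ?_⟩
    have : (1 : ℝ) / 2 ^ (m + 2) ≤ (1 / 2) ^ m := by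
      rw [one_div_pow]
      gcongr <;> norm_num
    linarith
  set θ : ℝ := 3 * ((1 : ℝ) / 2 ^ (m + 2)) with hθ
  have hθ0 : 0 ≤ θ := by positivity
  have hl : 1 < 2 ^ (m + 2) := Nat.one_lt_two_pow (by omega)
  let i : (m : ℕ) × Fin (2 ^ m) × WickIndex n := ⟨m + 2, ⟨1, hl⟩, 0⟩
  have h1 : ∀ γ : WickIndex n, ∃ β, 1 ≤ ‖structureConst (wickBasis n hħ) (wickStar hħ) γ β γ‖ₑ :=
    fun γ => ⟨0, by simp [structureConst_zero_right]⟩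
  have h2 : ∀ γ : WickIndex n, ∃ β, 1 ≤ ‖structureConst (wickBasis n hħ) (wickStar hħ) β γ γ‖ₑ :=
    fun γ => ⟨0, by simp [structureConst_zero_left]⟩
  have key : ∀ (f : WickAlgebra n hħ) α, ‖(wickBasis n hħ).repr f α‖ ≤
      (c ^ α.degree * (α.degree.factorial : ℝ)) ^ θ * wickSeminorm hħ i f := by
    intro f α
    obtain ⟨μ, β, α', h3, h4⟩ := h α
    set D : ℝ := c ^ α.degree * (α.degree.factorial : ℝ)
    have hD : 0 ≤ D := by positivity
    have hen : ∀ z : ℂ, 1 ≤ D * ‖z‖ → 1 ≤ ENNReal.ofReal D * ‖z‖ₑ := fun z hz => by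
      rw [← ofReal_norm, ← ENNReal.ofReal_mul hD]
      exact ENNReal.one_le_ofReal.2 hz
    have hle := enorm_pow_le_mul_recH h1 h2 (hen _ h3) (hen _ h4) ((wickBasis n hħ).repr f) m
    have hle' := ENNReal.rpow_le_rpow hle (show (0 : ℝ) ≤ 1 / 2 ^ (m + 2) by positivity)
    rw [← ENNReal.rpow_natCast, ← ENNReal.rpow_mul, ENNReal.mul_rpow_of_nonneg _ _ (by positivity),
      ← ENNReal.rpow_natCast, ← ENNReal.rpow_mul, Nat.cast_pow, Nat.cast_ofNat, Nat.cast_ofNat,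
      mul_one_div_cancel (by positivity), ENNReal.rpow_one, ← hθ,
      ENNReal.ofReal_rpow_of_nonneg hD hθ0] at hle'
    change _ ≤ _ * recNorm (wickBasis n hħ) (wickStar hħ) (m + 2) (⟨1, hl⟩ : Fin (2 ^ (m + 2))) 0 f
      at hle'
    rw [← ofReal_wickSeminorm, ← ENNReal.ofReal_mul (by positivity), ← ofReal_norm] at hle'
    exact (ENNReal.ofReal_le_ofReal_iff (mul_nonneg (by positivity) (apply_nonneg _ _))).1 hle'
  have hsum := summable_pow_mul_factorial_rpow (σ := Fin n ⊕ Fin n) (c := c ^ θ) (δ := ε / 2)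
    (by positivity) (by positivity)
  refine ⟨i, ⟨∑' N : WickIndex n, (c ^ θ) ^ N.degree *
    (N.degree.factorial : ℝ) ^ (-(ε / 2 : ℝ)), tsum_nonneg fun _ => by positivity⟩, fun f => ?_⟩
  change _ ≤ (∑' N : WickIndex n, (c ^ θ) ^ N.degree *
    (N.degree.factorial : ℝ) ^ (-(ε / 2 : ℝ))) * _
  rw [← tsum_mul_right, KoetheSpace.seminorm_apply]
  refine ((wickCoeff hħ f).summable ε.2).tsum_le_tsum (fun N => ?_) (hsum.mul_right _)
  rw [div_le_iff₀ (by positivity)]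
  refine (key f N).trans ?_
  rw [mul_right_comm]
  refine mul_le_mul_of_nonneg_right ?_ (apply_nonneg _ _)
  rw [Real.mul_rpow (by positivity) (by positivity), mul_assoc, ← Real.rpow_add (by positivity),
    ← Real.rpow_natCast, ← Real.rpow_mul hc0, ← Real.rpow_natCast, ← Real.rpow_mul hc0,
    mul_comm θ]
  gcongr
  · exact_mod_cast N.degree.factorial_pos
  · linarith

theorem withSeminorms_koethe_comp_wickCoeff :
    WithSeminorms (SeminormFamily.comp (koetheSeminorm (Fin n ⊕ Fin n)) (wickCoeff hħ)) := by
  refine (withSeminorms_wickSeminorm hħ).congr (fun ε => ?_) (fun i => ?_)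
  · obtain ⟨i, C, h⟩ := exists_koetheSeminorm_wickCoeff_le hħ ε
    refine ⟨{i}, C, fun f => ?_⟩
    rw [Finset.sup_singleton]
    exact h f
  · obtain ⟨m, l, γ⟩ := i
    obtain ⟨ε, C, h⟩ := exists_recNorm_le hħ m γ
    refine ⟨{ε}, C, fun f => ?_⟩
    have := h l f
    rw [← ofReal_wickSeminorm] at this
    rw [Finset.sup_singleton]
    exact (ENNReal.ofReal_le_ofReal_iff
      (mul_nonneg C.2 (apply_nonneg (koetheSeminorm _ ε) _))).1 this

theorem isInducing_wickCoeff : IsInducing (wickCoeff (n := n) hħ) := by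
  constructor
  have h := (wickCoeff (n := n) hħ).withSeminorms_induced KoetheSpace.withSeminorms
  rw [(withSeminorms_koethe_comp_wickCoeff hħ).1]
  exact (@WithSeminorms.topology_eq_withSeminorms _ _ _ _ _ _ _ (_) h).symm

theorem denseRange_wickCoeff : DenseRange (wickCoeff (n := n) hħ) := by
  have h : Set.range (wickCoeff (n := n) hħ) = Set.range KoetheSpace.ofFinsupp := by
    rw [wickCoeff, LinearMap.coe_comp]
    exact (wickBasis n hħ).repr.surjective.range_comp _
  rw [DenseRange, h]
  exact KoetheSpace.denseRange_ofFinsupp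

/-- The Wick star product as a bilinear map on the Weyl algebra. -/
def wickStarₗ : WickAlgebra n hħ →ₗ[ℂ] WickAlgebra n hħ →ₗ[ℂ] WickAlgebra n hħ := polyStarₗ ħ

@[simp] theorem wickStarₗ_apply (f g : WickAlgebra n hħ) : wickStarₗ hħ f g = wickStar hħ f g :=
  rfl

/-- The structure constant estimate separates the indices, so it suffices to bound products of basis
vectors and expand bilinearly. -/
theorem exists_koetheSeminorm_wickStar_le (ε : Set.Ioo (0 : ℝ) 1) :
    ∃ (ε' : Set.Ioo (0 : ℝ) 1) (C : ℝ), ∀ f g : WickAlgebra n hħ,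
      koetheSeminorm _ ε (wickCoeff hħ (wickStar hħ f g)) ≤
        C * (koetheSeminorm _ ε' (wickCoeff hħ f) * koetheSeminorm _ ε' (wickCoeff hħ g)) := by
  obtain ⟨c, hc, hK⟩ := exists_norm_structureConst_le n hħ
  have hε := ε.2.1
  have hε1 := ε.2.2
  have hc0 : 0 ≤ c := by linarith
  obtain ⟨B, hB, hBk⟩ := exists_pow_le_factorial_rpow hc0 (show (0 : ℝ) < ε / 8 by positivity)
  let ε' : Set.Ioo (0 : ℝ) 1 := ⟨ε / 8, by positivity, by linarith⟩
  have hS := summable_pow_mul_factorial_rpow (σ := Fin n ⊕ Fin n) (c := c) (δ := ε / 2)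
    hc0 (by positivity)
  set S := ∑' N : WickIndex n, c ^ N.degree * (N.degree.factorial : ℝ) ^ (-(ε / 2 : ℝ)) with hSdef
  have hA : ∀ α : WickIndex n, c ^ α.degree * (α.degree.factorial : ℝ) ^ (-(ε / 4 : ℝ)) ≤
      B / (α.degree.factorial : ℝ) ^ (ε / 8 : ℝ) := by
    intro α
    calc _ ≤ B * (α.degree.factorial : ℝ) ^ (ε / 8 : ℝ) *
          (α.degree.factorial : ℝ) ^ (-(ε / 4 : ℝ)) := by gcongr; exact hBk _
      _ = _ := by
          rw [mul_assoc, ← Real.rpow_add (by positivity), div_eq_mul_inv B,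
            ← Real.rpow_neg (by positivity)]
          congr 2
          ring
  have hbasis : ∀ α β : WickIndex n,
      koetheSeminorm _ ε (wickCoeff hħ (wickStar hħ (wickBasis n hħ α) (wickBasis n hħ β))) ≤
        (B / (α.degree.factorial : ℝ) ^ (ε / 8 : ℝ)) *
          ((B / (β.degree.factorial : ℝ) ^ (ε / 8 : ℝ)) * S) := by
    intro α β
    rw [KoetheSpace.seminorm_apply, hSdef, ← tsum_mul_left, ← tsum_mul_left]
    refine (KoetheSpace.summable _ ε.2).tsum_le_tsum (fun γ => ?_)
      ((hS.mul_left _).mul_left _)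
    rw [div_le_iff₀ (by positivity)]
    -- With η = ε/4 the growth in γ has exponent ε/2, half of the weight. In α and β the decay ε/4
    -- absorbs `c` at the expense of ε/8.
    refine (hK (ε / 4) (by positivity) (by linarith) α β γ).trans ?_
    have hγ : c ^ γ.degree * (γ.degree.factorial : ℝ) ^ (2 * (ε / 4 : ℝ)) =
        c ^ γ.degree * (γ.degree.factorial : ℝ) ^ (-(ε / 2 : ℝ)) *
          (γ.degree.factorial : ℝ) ^ (ε : ℝ) := by
      rw [mul_assoc, ← Real.rpow_add (by positivity)]
      congr 2
      ring
    rw [hγ, mul_assoc (_ / _), mul_assoc (_ / _)]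
    gcongr <;> exact hA _
  refine ⟨ε', B * B * S, fun f g => ?_⟩
  let q : Seminorm ℂ (WickAlgebra n hħ) := (koetheSeminorm _ ε).comp (wickCoeff hħ)
  have hexp : ∀ f : WickAlgebra n hħ, f = ∑ α ∈ ((wickBasis n hħ).repr f).support,
      (wickBasis n hħ).repr f α • wickBasis n hħ α := fun f => by
    conv_lhs => rw [← (wickBasis n hħ).linearCombination_repr f]
    rw [Finsupp.linearCombination_apply, Finsupp.sum]
  have hsub : ∀ (s : Finset (WickIndex n)) (x : WickIndex n → WickAlgebra n hħ),
      q (∑ α ∈ s, x α) ≤ ∑ α ∈ s, q (x α) := fun s x =>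
    Finset.le_sum_of_subadditive q (map_zero q).le (map_add_le_add q) s x
  have hnorm : ∀ (f : WickAlgebra n hħ), ∑ α ∈ ((wickBasis n hħ).repr f).support,
      ‖(wickBasis n hħ).repr f α‖ / (α.degree.factorial : ℝ) ^ (ε / 8 : ℝ) ≤
        koetheSeminorm _ ε' (wickCoeff hħ f) := fun f => by
    rw [KoetheSpace.seminorm_apply]
    exact ((wickCoeff hħ f).summable ε'.2).sum_le_tsum _ fun _ _ => by positivity
  set s := ((wickBasis n hħ).repr f).support with hs
  set t := ((wickBasis n hħ).repr g).support with ht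
  have hS0 : 0 ≤ S := tsum_nonneg fun _ => by positivity
  calc q (wickStar hħ f g)
      = q (∑ α ∈ s, ∑ β ∈ t, ((wickBasis n hħ).repr f α * (wickBasis n hħ).repr g β) •
          wickStar hħ (wickBasis n hħ α) (wickBasis n hħ β)) := by
        congr 1
        rw [← wickStarₗ_apply]
        conv_lhs => rw [hexp f, hexp g]
        simp only [map_sum, LinearMap.sum_apply, map_smul, LinearMap.smul_apply, wickStarₗ_apply,
          smul_smul, Finset.smul_sum]
        rw [Finset.sum_comm]
        simp only [mul_comm]
        rfl
    _ ≤ ∑ α ∈ s, ∑ β ∈ t, ‖(wickBasis n hħ).repr f α‖ * ‖(wickBasis n hħ).repr g β‖ *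
          ((B / (α.degree.factorial : ℝ) ^ (ε / 8 : ℝ)) *
          ((B / (β.degree.factorial : ℝ) ^ (ε / 8 : ℝ)) * S)) := by
        refine (hsub _ _).trans (Finset.sum_le_sum fun α _ => (hsub _ _).trans
          (Finset.sum_le_sum fun β _ => ?_))
        rw [map_smul_eq_mul, norm_mul]
        gcongr
        exact hbasis α β
    _ = B * B * S * ((∑ α ∈ s, ‖(wickBasis n hħ).repr f α‖ /
          (α.degree.factorial : ℝ) ^ (ε / 8 : ℝ)) * ∑ β ∈ t, ‖(wickBasis n hħ).repr g β‖ /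
          (β.degree.factorial : ℝ) ^ (ε / 8 : ℝ)) := by
        rw [Finset.sum_mul_sum, Finset.mul_sum]
        refine Finset.sum_congr rfl fun α _ => ?_
        rw [Finset.mul_sum]
        refine Finset.sum_congr rfl fun β _ => ?_
        ring
    _ ≤ _ := by
        gcongr
        · exact hnorm f
        · exact hnorm g

theorem continuous_wickStar :
    Continuous fun x : WickAlgebra n hħ × WickAlgebra n hħ => wickStar hħ x.1 x.2 := by
  have := (withSeminorms_wickSeminorm (n := n) hħ).topologicalAddGroup
  rw [(isInducing_wickCoeff hħ).continuous_iff, continuous_iff_continuousAt]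
  rintro ⟨f₀, g₀⟩
  rw [ContinuousAt, KoetheSpace.withSeminorms.tendsto_nhds]
  intro ε η hη
  obtain ⟨ε', C, h⟩ := exists_koetheSeminorm_wickStar_le (n := n) hħ ε
  let q : Seminorm ℂ (WickAlgebra n hħ) := (koetheSeminorm _ ε').comp (wickCoeff hħ)
  have hq : Continuous q :=
    (KoetheSpace.continuous_seminorm ε').comp (isInducing_wickCoeff hħ).continuous
  let F : WickAlgebra n hħ × WickAlgebra n hħ → ℝ := fun x =>
    C * (q (x.1 - f₀) * q (x.2 - g₀)) + C * (q (x.1 - f₀) * q g₀) + C * (q f₀ * q (x.2 - g₀))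
  have hF : Continuous F := by fun_prop
  have hF0 : F (f₀, g₀) = 0 := by simp [F]
  have hev : ∀ᶠ x in 𝓝 (f₀, g₀), F x < η := by
    refine hF.continuousAt.eventually_lt continuousAt_const ?_
    rw [hF0]
    exact hη
  filter_upwards [hev] with x hx
  refine lt_of_le_of_lt ?_ hx
  have hsplit : wickStar hħ x.1 x.2 - wickStar hħ f₀ g₀ =
      wickStar hħ (x.1 - f₀) (x.2 - g₀) + wickStar hħ (x.1 - f₀) g₀ +
        wickStar hħ f₀ (x.2 - g₀) := by
    simp only [← wickStarₗ_apply, map_sub, LinearMap.sub_apply]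
    abel
  simp only [Function.comp_apply]
  rw [← map_sub, hsplit, map_add (wickCoeff hħ), map_add (wickCoeff hħ)]
  refine (map_add_le_add _ _ _).trans (add_le_add ((map_add_le_add _ _ _).trans
    (add_le_add (h _ _) (h _ _))) (h _ _))

end Wick

/-! ### Completions -/

section Completion

variable {A E F : Type*} [AddCommGroup A] [Module ℂ A] [TopologicalSpace A]
  [AddCommGroup E] [Module ℂ E] [UniformSpace E]
  [AddCommGroup F] [Module ℂ F] [UniformSpace F]

/-- A jointly continuous biadditive map extends from a dense subgroup to a complete target;
compatibility with scalars is a closed condition. -/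
theorem IsTVSCompletion.exists_bilinear {j : A →ₗ[ℂ] E} (hj : IsTVSCompletion j)
    (B : A →ₗ[ℂ] A →ₗ[ℂ] A) (hB : Continuous fun x : A × A => B x.1 x.2) :
    ∃ mul : E →ₗ[ℂ] E →ₗ[ℂ] E, Continuous (fun x : E × E => mul x.1 x.2) ∧
      ∀ a b, mul (j a) (j b) = j (B a b) := by
  have := hj.isUniformAddGroup
  have := hj.continuousSMul
  have := hj.completeSpace
  have := hj.t2Space
  have hjc := hj.isInducing.continuous
  have de : IsDenseInducing j.toAddMonoidHom := ⟨hj.isInducing, hj.denseRange⟩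
  let φ : A →+ A →+ E := AddMonoidHom.mk' (fun a => (j ∘ₗ B a).toAddMonoidHom) fun a b => by
    ext c
    simp
  have hφ : Continuous fun p : A × A => φ p.1 p.2 := hjc.comp hB
  let M : E × E → E := (de.prodMap de).extend fun p : A × A => φ p.1 p.2
  have hM : Continuous M := de.extend_Z_bilin de hφ
  have hMj : ∀ a b, M (j a, j b) = j (B a b) := fun a b =>
    (de.prodMap de).extend_eq hφ (a, b)
  have hd := hj.denseRange
  refine ⟨LinearMap.mk₂ ℂ (fun x y => M (x, y)) (fun x x' y => ?_) (fun c x y => ?_)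
    (fun x y y' => ?_) (fun c x y => ?_), hM, hMj⟩
  · refine hd.induction_on₃ (p := fun x x' y => M (x + x', y) = M (x, y) + M (x', y))
      (isClosed_eq (by fun_prop) (by fun_prop)) (fun a a' b => ?_) x x' y
    rw [← map_add, hMj, hMj, hMj, map_add, LinearMap.add_apply, map_add]
  · refine hd.induction_on₂ (p := fun x y => M (c • x, y) = c • M (x, y))
      (isClosed_eq (by fun_prop) (by fun_prop)) (fun a b => ?_) x y
    rw [← map_smul, hMj, hMj, map_smul, LinearMap.smul_apply, map_smul]
  · refine hd.induction_on₃ (p := fun x y y' => M (x, y + y') = M (x, y) + M (x, y'))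
      (isClosed_eq (by fun_prop) (by fun_prop)) (fun a b b' => ?_) x y y'
    rw [← map_add, hMj, hMj, hMj, map_add, map_add]
  · refine hd.induction_on₂ (p := fun x y => M (x, c • y) = c • M (x, y))
      (isClosed_eq (by fun_prop) (by fun_prop)) (fun a b => ?_) x y
    rw [← map_smul, hMj, hMj, map_smul, map_smul]

variable [IsTopologicalAddGroup A]

theorem IsTVSCompletion.exists_extension [IsUniformAddGroup F] [ContinuousSMul ℂ F]
    [CompleteSpace F] [T2Space F] {j : A →ₗ[ℂ] E} (hj : IsTVSCompletion j) {k : A →ₗ[ℂ] F}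
    (hk : Continuous k) : ∃ Φ : E →L[ℂ] F, ∀ a, Φ (j a) = k a := by
  let _ : UniformSpace A := IsTopologicalAddGroup.rightUniformSpace A
  have : IsUniformAddGroup A := isUniformAddGroup_of_addCommGroup
  have := hj.isUniformAddGroup
  have := hj.continuousSMul
  have hu := AddMonoidHom.isUniformInducing_of_isInducing hj.isInducing
  let jL : A →L[ℂ] E := ⟨j, hj.isInducing.continuous⟩
  let kL : A →L[ℂ] F := ⟨k, hk⟩
  exact ⟨kL.extend jL, fun a => kL.extend_eq (e := jL) hj.denseRange hu a⟩

/-- The extensions of each embedding along the other are mutually inverse on dense subspaces, hence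
everywhere. This reduces statements about all completions to the Köthe space. -/
theorem IsTVSCompletion.exists_equiv {j : A →ₗ[ℂ] E} (hj : IsTVSCompletion j) {k : A →ₗ[ℂ] F}
    (hk : IsTVSCompletion k) : ∃ Φ : E ≃L[ℂ] F, ∀ a, Φ (j a) = k a := by
  have := hj.isUniformAddGroup
  have := hj.continuousSMul
  have := hj.completeSpace
  have := hj.t2Space
  have := hk.isUniformAddGroup
  have := hk.continuousSMul
  have := hk.completeSpace
  have := hk.t2Space
  obtain ⟨Φ, hΦ⟩ := hj.exists_extension hk.isInducing.continuous
  obtain ⟨Ψ, hΨ⟩ := hk.exists_extension hj.isInducing.continuous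
  refine ⟨ContinuousLinearEquiv.equivOfInverse Φ Ψ (fun x => ?_) (fun x => ?_), hΦ⟩
  · refine hj.denseRange.induction_on x (isClosed_eq (Ψ.continuous.comp Φ.continuous)
      continuous_id) fun a => ?_
    exact (congrArg Ψ (hΦ a)).trans (hΨ a)
  · refine hk.denseRange.induction_on x (isClosed_eq (Φ.continuous.comp Ψ.continuous)
      continuous_id) fun a => ?_
    exact (congrArg Φ (hΨ a)).trans (hΦ a)

theorem IsStronglyNuclear.of_equiv {E F : Type*} [AddCommGroup E] [Module ℂ E]
    [TopologicalSpace E] [AddCommGroup F] [Module ℂ F] [TopologicalSpace F] (Φ : E ≃L[ℂ] F)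
    (hF : IsStronglyNuclear F) : IsStronglyNuclear E := by
  intro p hp
  obtain ⟨q, hq, lam, f, y, h1, h2, h3, h4⟩ := hF (p.comp Φ.symm.toLinearEquiv.toLinearMap)
    (hp.comp Φ.symm.continuous)
  refine ⟨q.comp Φ.toLinearEquiv.toLinearMap, hq.comp Φ.continuous, lam,
    fun k => (f k).comp (Φ : E →L[ℂ] F), fun k => Φ.symm (y k), h1, fun k x => h2 k (Φ x), h3,
    fun x => (h4 (Φ x)).congr fun M => ?_⟩
  change p (Φ.symm _) = _
  simp

open scoped Classical in
theorem IsAbsoluteSchauderBasis.of_equiv {ι E F : Type*} [AddCommGroup E] [Module ℂ E]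
    [TopologicalSpace E] [AddCommGroup F] [Module ℂ F] [TopologicalSpace F] (Φ : E ≃L[ℂ] F)
    {e : ι → F} {c : ι → F →L[ℂ] ℂ} (h : IsAbsoluteSchauderBasis e c) {e' : ι → E}
    (he : ∀ k, Φ (e' k) = e k) :
    IsAbsoluteSchauderBasis e' fun k => (c k).comp (Φ : E →L[ℂ] F) := by
  have he' : ∀ k, e' k = Φ.symm (e k) := fun k => by rw [← he, Φ.symm_apply_apply]
  refine ⟨fun k l => ?_, fun x => ?_, fun p hp => ?_⟩
  · rw [← h.biorthogonal k l, ← he]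
    rfl
  · have := (h.hasSum (Φ x)).mapL (Φ.symm : F →L[ℂ] E)
    simpa [he'] using this
  · obtain ⟨q, hq, hs⟩ := h.absolute (p.comp Φ.symm.toLinearEquiv.toLinearMap)
      (hp.comp Φ.symm.continuous)
    refine ⟨q.comp Φ.toLinearEquiv.toLinearMap, hq.comp Φ.continuous, fun x => ?_⟩
    have := hs (Φ x)
    simp only [he']
    exact this

variable {n : ℕ} {ħ : ℝ} (hħ : 0 < ħ)

theorem isTVSCompletion_wickCoeff : IsTVSCompletion (wickCoeff (n := n) hħ) where
  isUniformAddGroup := inferInstance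
  continuousSMul := inferInstance
  completeSpace := inferInstance
  t2Space := inferInstance
  isInducing := isInducing_wickCoeff hħ
  denseRange := denseRange_wickCoeff hħ

theorem IsTVSCompletion.exists_wick_mul {j : WickAlgebra n hħ →ₗ[ℂ] E} (hj : IsTVSCompletion j) :
    ∃ mul : E →ₗ[ℂ] E →ₗ[ℂ] E,
      Continuous (fun x : E × E => mul x.1 x.2) ∧
      (∀ f g, mul (j f) (j g) = j (wickStar hħ f g)) ∧
      (∀ x y z, mul (mul x y) z = mul x (mul y z)) ∧
      (∀ x, mul (j (1 : MvPolynomial (Fin n ⊕ Fin n) ℂ)) x = x ∧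
        mul x (j (1 : MvPolynomial (Fin n ⊕ Fin n) ℂ)) = x) := by
  have := (withSeminorms_wickSeminorm (n := n) hħ).topologicalAddGroup
  have := hj.t2Space
  obtain ⟨mul, hc, hmul⟩ := hj.exists_bilinear (wickStarₗ hħ) (continuous_wickStar hħ)
  refine ⟨mul, hc, hmul, fun x y z => ?_, fun x => ⟨?_, ?_⟩⟩
  · refine hj.denseRange.induction_on₃ (p := fun x y z => mul (mul x y) z = mul x (mul y z))
      (isClosed_eq ?_ ?_) (fun f g h => ?_) x y z
    · exact hc.comp ((hc.comp (continuous_fst.prodMk (continuous_fst.comp continuous_snd))).prodMk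
        (continuous_snd.comp continuous_snd))
    · exact hc.comp (continuous_fst.prodMk (hc.comp continuous_snd))
    · rw [hmul, hmul, hmul, hmul]
      exact congrArg j (polyStar_assoc ħ f g h)
  · refine hj.denseRange.induction_on (p := fun x => mul _ x = x) x
      (isClosed_eq (hc.comp (continuous_const.prodMk continuous_id)) continuous_id) fun f => ?_
    exact (hmul _ f).trans (congrArg j (one_polyStar ħ f))
  · refine hj.denseRange.induction_on (p := fun x => mul x _ = x) x
      (isClosed_eq (hc.comp (continuous_id.prodMk continuous_const)) continuous_id) fun f => ?_
    exact (hmul f _).trans (congrArg j (polyStar_one ħ f))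

theorem IsTVSCompletion.isFrechetSpace {j : WickAlgebra n hħ →ₗ[ℂ] E} (hj : IsTVSCompletion j) :
    IsFrechetSpace E where
  isUniformAddGroup := hj.isUniformAddGroup
  completeSpace := hj.completeSpace
  t2Space := hj.t2Space
  exists_seminorms := by
    have := (withSeminorms_wickSeminorm (n := n) hħ).topologicalAddGroup
    obtain ⟨Φ, hΦ⟩ := hj.exists_equiv (isTVSCompletion_wickCoeff hħ)
    exact ⟨_, IsInducing.withSeminorms KoetheSpace.withSeminorms_countableFamily
      (f := Φ.toLinearEquiv.toLinearMap) Φ.toHomeomorph.isInducing⟩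

end Completion

/-! ### Power series in several real linear forms -/

section PowerSeries

variable {σ V : Type*} [Fintype σ] [NormedAddCommGroup V] [NormedSpace ℝ V]

/-- The variables are listed with multiplicity and each is applied to its own argument. The degree
condition guards only the diagonal values, so that `M` can be chosen for all `k` and `N`, with 0 as
a dummy. -/
theorem exists_multilinear_monomial {L : σ → V →L[ℝ] ℂ} (hL : ∀ i, ‖L i‖ ≤ 1) (k : ℕ)
    (N : σ →₀ ℕ) : ∃ M : ContinuousMultilinearMap ℝ (fun _ : Fin k => V) ℂ, ‖M‖ ≤ 1 ∧
      (N.degree = k → ∀ z, M (fun _ => z) = ∏ i, L i z ^ N i) := by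
  by_cases hk : N.degree = k
  swap
  · exact ⟨0, by simp, fun h => absurd h hk⟩
  have key : ∀ (l : List σ) (k : ℕ), l.length = k →
      ∃ M : ContinuousMultilinearMap ℝ (fun _ : Fin k => V) ℂ, ‖M‖ ≤ 1 ∧
        ∀ z, M (fun _ => z) = (l.map fun i => L i z).prod := by
    rintro l _ rfl
    refine ⟨(ContinuousMultilinearMap.mkPiAlgebraFin ℝ l.length ℂ).compContinuousLinearMap
      fun j => L (l.get j), ?_, fun z => ?_⟩
    · refine (ContinuousMultilinearMap.norm_compContinuousLinearMap_le _ _).trans ?_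
      rw [ContinuousMultilinearMap.norm_mkPiAlgebraFin, one_mul]
      exact Finset.prod_le_one (fun _ _ => norm_nonneg _) fun j _ => hL _
    · rw [ContinuousMultilinearMap.compContinuousLinearMap_apply,
        ContinuousMultilinearMap.mkPiAlgebraFin_apply]
      congr 1
      apply List.ext_get <;> simp
  obtain ⟨M, hM, h⟩ := key (Finsupp.toMultiset N).toList k (by
    rw [Multiset.length_toList, Finsupp.card_toMultiset, ← hk, Finsupp.degree_eq_sum,
      Finsupp.sum_fintype _ _ fun _ => rfl]
    rfl)
  refine ⟨M, hM, fun _ z => (h z).trans ?_⟩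
  rw [← Multiset.prod_coe, ← Multiset.map_coe, Multiset.coe_toList, Finsupp.toMultiset_map,
    Finsupp.prod_toMultiset, Finsupp.prod_mapDomain_index (fun _ => pow_zero _)
    (fun _ _ _ => pow_add _ _ _), Finsupp.prod_fintype _ _ fun _ => pow_zero _]

theorem mem_finsuppAntidiag_univ [DecidableEq σ] {k : ℕ} {N : σ →₀ ℕ} :
    N ∈ Finset.univ.finsuppAntidiag k ↔ N.degree = k := by
  rw [Finset.mem_finsuppAntidiag, Finsupp.degree_eq_sum]
  simp

theorem norm_prod_linearForm_le {L : σ → V →L[ℝ] ℂ} (hL : ∀ i, ‖L i‖ ≤ 1) (N : σ →₀ ℕ) (z : V) :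
    ‖∏ i, L i z ^ N i‖ ≤ ‖z‖ ^ N.degree := by
  rw [norm_prod, Finsupp.degree_eq_sum, ← Finset.prod_pow_eq_pow_sum]
  refine Finset.prod_le_prod (fun _ _ => norm_nonneg _) fun i _ => ?_
  rw [norm_pow]
  gcongr
  simpa using (L i).le_of_opNorm_le (hL i) z

theorem summable_mul_prod_linearForm {L : σ → V →L[ℝ] ℂ} (hL : ∀ i, ‖L i‖ ≤ 1)
    {b : (σ →₀ ℕ) → ℂ} (hb : ∀ R : ℝ, 0 ≤ R → Summable fun N => ‖b N‖ * R ^ N.degree) (z : V) :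
    Summable fun N => b N * ∏ i, L i z ^ N i := by
  refine Summable.of_norm_bounded (hb ‖z‖ (norm_nonneg z)) fun N => ?_
  rw [norm_mul]
  gcongr
  exact norm_prod_linearForm_le hL N z

/-- The absolutely convergent sum is regrouped by degree, and the products of contractions preserve
the bound on the coefficients. The scalars are real since conjugation is not complex linear. -/
theorem exists_hasFPowerSeriesOnBall [DecidableEq σ] {L : σ → V →L[ℝ] ℂ} (hL : ∀ i, ‖L i‖ ≤ 1)
    {b : (σ →₀ ℕ) → ℂ} (hb : ∀ R : ℝ, 0 ≤ R → Summable fun N => ‖b N‖ * R ^ N.degree) :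
    ∃ p : FormalMultilinearSeries ℝ V ℂ,
      HasFPowerSeriesOnBall (fun z => ∑' N, b N * ∏ i, L i z ^ N i) p 0 ⊤ ∧
      ∀ k z, p k (fun _ => z) =
        ∑ N ∈ Finset.univ.finsuppAntidiag k, b N * ∏ i, L i z ^ N i := by
  choose M hM hMz using exists_multilinear_monomial hL
  let p : FormalMultilinearSeries ℝ V ℂ := fun k =>
    ∑ N ∈ Finset.univ.finsuppAntidiag k, b N • M k N
  have hp : ∀ k z, p k (fun _ => z) =
      ∑ N ∈ Finset.univ.finsuppAntidiag k, b N * ∏ i, L i z ^ N i := by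
    intro k z
    simp only [p, _root_.sum_apply, _root_.smul_apply,
      smul_eq_mul]
    exact Finset.sum_congr rfl fun N hN => by rw [hMz k N (mem_finsuppAntidiag_univ.1 hN)]
  refine ⟨p, ⟨?_, by simp, fun {y} _ => ?_⟩, hp⟩
  · refine ENNReal.le_of_forall_nnreal_lt fun r _ => ?_
    refine p.le_radius_of_bound (∑' N, ‖b N‖ * (r : ℝ) ^ N.degree) fun k => ?_
    calc ‖p k‖ * (r : ℝ) ^ k
        ≤ (∑ N ∈ Finset.univ.finsuppAntidiag k, ‖b N‖) * (r : ℝ) ^ k := by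
          gcongr
          refine (norm_sum_le _ _).trans (Finset.sum_le_sum fun N _ => ?_)
          rw [norm_smul]
          exact mul_le_of_le_one_right (norm_nonneg _) (hM k N)
      _ = ∑ N ∈ Finset.univ.finsuppAntidiag k, ‖b N‖ * (r : ℝ) ^ N.degree := by
          rw [Finset.sum_mul]
          exact Finset.sum_congr rfl fun N hN => by rw [mem_finsuppAntidiag_univ.1 hN]
      _ ≤ _ := (hb r r.2).sum_le_tsum _ fun _ _ => by positivity
  · have hs := (summable_mul_prod_linearForm hL hb y).hasSum
    rw [← (Equiv.sigmaFiberEquiv fun N : σ →₀ ℕ => N.degree).hasSum_iff] at hs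
    rw [zero_add]
    refine hs.sigma fun k => ?_
    rw [hp]
    have h := Finset.hasSum (Finset.univ.finsuppAntidiag k) fun N => b N * ∏ i, L i y ^ N i
    let e : {N : σ →₀ ℕ // N.degree = k} ≃
        ((Finset.univ.finsuppAntidiag k : Finset (σ →₀ ℕ)) : Set (σ →₀ ℕ)) :=
      Equiv.subtypeEquivRight fun N => mem_finsuppAntidiag_univ.symm
    have h' := (e.hasSum_iff (f := (fun N => b N * ∏ i, L i y ^ N i) ∘ Subtype.val)).2 h
    exact h'

end PowerSeries

/-! ### Elements of the completion as real-analytic functions -/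

section Eval

variable {n : ℕ}

/-- The coordinates `z^k` and `z̄^k` as real linear forms on `ℂⁿ`. -/
def coordForm (n : ℕ) : Fin n ⊕ Fin n → (Fin n → ℂ) →L[ℝ] ℂ :=
  Sum.elim (fun k => ContinuousLinearMap.proj k)
    fun k => (Complex.conjCLE : ℂ →L[ℝ] ℂ).comp (ContinuousLinearMap.proj k)

theorem coordForm_apply (z : Fin n → ℂ) (i : Fin n ⊕ Fin n) :
    coordForm n i z = Sum.elim z (fun k => starRingEnd ℂ (z k)) i := by
  rcases i with k | k <;> rfl

theorem norm_coordForm_le (i : Fin n ⊕ Fin n) : ‖coordForm n i‖ ≤ 1 := by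
  refine ContinuousLinearMap.opNorm_le_bound _ zero_le_one fun z => ?_
  rw [coordForm_apply, one_mul]
  rcases i with k | k
  · exact norm_le_pi_norm z k
  · simpa using norm_le_pi_norm z k

/-- In the variables $u,v$ with $z=u+iv$, $\bar z=u-iv$ the polynomial vanishes at all real points,
hence identically; the linear substitution is invertible over ℂ. -/
theorem MvPolynomial.eq_zero_of_eval_conj_eq_zero {P : MvPolynomial (Fin n ⊕ Fin n) ℂ}
    (h : ∀ z : Fin n → ℂ, MvPolynomial.eval (Sum.elim z fun k => starRingEnd ℂ (z k)) P = 0) :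
    P = 0 := by
  let s : Fin n ⊕ Fin n → MvPolynomial (Fin n ⊕ Fin n) ℂ :=
    Sum.elim (fun k => X (Sum.inl k) + C Complex.I * X (Sum.inr k))
      fun k => X (Sum.inl k) - C Complex.I * X (Sum.inr k)
  have heval : ∀ u, eval u (bind₁ s P) = eval (Sum.elim
      (fun k => u (Sum.inl k) + Complex.I * u (Sum.inr k))
      fun k => u (Sum.inl k) - Complex.I * u (Sum.inr k)) P := by
    intro u
    rw [eval, eval₂Hom_bind₁]
    congr 2
    funext i
    rcases i with k | k <;> simp [s]
  have hQ : bind₁ s P = 0 := by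
    refine funext_set (fun _ => Set.range ((↑) : ℝ → ℂ))
      (fun _ => Set.infinite_range_of_injective Complex.ofReal_injective) fun u hu => ?_
    rw [map_zero, heval]
    choose v hv using fun i => hu i (Set.mem_univ i)
    convert h (fun k => u (Sum.inl k) + Complex.I * u (Sum.inr k)) using 3
    funext k
    rcases k with k | k
    · rfl
    · simp only [Sum.elim_inr]
      rw [← hv, ← hv]
      simp [sub_eq_add_neg]
  refine MvPolynomial.funext fun w => ?_
  -- The inverse substitution $u=(z+\bar z)/2$, $v=(z-\bar z)/(2i)$ reaches every complex point.
  have := heval (Sum.elim (fun k => (w (Sum.inl k) + w (Sum.inr k)) / 2)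
    fun k => (w (Sum.inl k) - w (Sum.inr k)) / (2 * Complex.I))
  rw [hQ, map_zero] at this
  rw [map_zero, this]
  congr 2
  funext i
  rcases i with k | k
  · simp; field_simp; ring
  · simp; field_simp; ring

variable {ħ : ℝ} (hħ : 0 < ħ)

theorem wickBasis_eval (N : WickIndex n) (z : Fin n → ℂ) :
    (wickBasis n hħ N).eval z = wickScale n ħ N * ∏ i, coordForm n i z ^ N i := by
  rw [wickBasis_apply]
  refine (MvPolynomial.eval_monomial ..).trans ?_
  rw [Finsupp.prod_fintype _ _ fun _ => pow_zero _]
  simp only [coordForm_apply]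

/-- Up to an exponential the scale is $1/|N|!$, while the coefficients grow at most like
$(|N|!)^{1/2}$; the remaining $(|N|!)^{-1/2}$ beats every `R ^ |N|`. -/
theorem summable_coeff_mul_wickScale (hħ : 0 < ħ) (a : KoetheSpace (Fin n ⊕ Fin n)) {R : ℝ}
    (hR : 0 ≤ R) : Summable fun N => ‖a.coeff N * wickScale n ħ N‖ * R ^ N.degree := by
  let ε : Set.Ioo (0 : ℝ) 1 := ⟨1 / 2, by norm_num⟩
  let c : ℝ := Fintype.card (Fin n ⊕ Fin n) / (2 * ħ) * R
  have hc : 0 ≤ c := by positivity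
  have hs := (summable_pow_mul_factorial_rpow (σ := Fin n ⊕ Fin n) (δ := 1 / 2) hc
    (by norm_num)).mul_left (koetheSeminorm _ ε a)
  refine Summable.of_nonneg_of_le (fun N => by positivity) (fun N => ?_) hs
  have h1 := KoetheSpace.norm_coeff_le a ε N
  have hP : (0 : ℝ) < (∏ k, (N k).factorial : ℕ) := by
    exact_mod_cast Finset.prod_pos fun _ _ => Nat.factorial_pos _
  have h2 : ‖wickScale n ħ N‖ ≤
      (Fintype.card (Fin n ⊕ Fin n) / (2 * ħ)) ^ N.degree * ((N.degree.factorial : ℝ))⁻¹ := by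
    have hf : (N.degree.factorial : ℝ) ≤ (Fintype.card (Fin n ⊕ Fin n) : ℝ) ^ N.degree *
        (∏ k, (N k).factorial : ℕ) := by
      have := factorial_sum_le (N : Fin n ⊕ Fin n → ℕ)
      rw [← Finsupp.degree_eq_sum] at this
      exact_mod_cast this
    rw [wickScale, norm_div, norm_one, norm_mul, norm_pow, Complex.norm_real,
      Real.norm_of_nonneg (by positivity), Complex.norm_natCast, div_pow, ← div_eq_mul_inv,
      div_div, div_le_div_iff₀ (by positivity) (by positivity), one_mul]
    calc _ ≤ (2 * ħ) ^ N.degree * ((Fintype.card (Fin n ⊕ Fin n) : ℝ) ^ N.degree *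
        (∏ k, (N k).factorial : ℕ)) := by gcongr
      _ = _ := by ring
  rw [norm_mul]
  calc _ ≤ (N.degree.factorial : ℝ) ^ (1 / 2 : ℝ) * koetheSeminorm _ ε a *
        ((Fintype.card (Fin n ⊕ Fin n) / (2 * ħ)) ^ N.degree * ((N.degree.factorial : ℝ))⁻¹) *
        R ^ N.degree := by
        gcongr
    _ = koetheSeminorm _ ε a * (c ^ N.degree * ((N.degree.factorial : ℝ) ^ (1 / 2 : ℝ) *
        (N.degree.factorial : ℝ) ^ (-1 : ℝ))) := by
        rw [Real.rpow_neg_one, mul_pow]; ring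
    _ = _ := by
        rw [← Real.rpow_add (by positivity)]
        norm_num

theorem summable_coeff_mul_eval (a : KoetheSpace (Fin n ⊕ Fin n)) (z : Fin n → ℂ) :
    Summable fun N => a.coeff N * (wickBasis n hħ N).eval z := by
  simp only [wickBasis_eval, ← mul_assoc]
  exact summable_mul_prod_linearForm norm_coordForm_le
    (fun R hR => summable_coeff_mul_wickScale hħ a hR) z

/-- The function on `ℂⁿ` given by an element of the Köthe space. -/
def koetheEval : KoetheSpace (Fin n ⊕ Fin n) →ₗ[ℂ] ((Fin n → ℂ) → ℂ) where
  toFun a z := ∑' N, a.coeff N * (wickBasis n hħ N).eval z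
  map_add' a b := by
    funext z
    rw [Pi.add_apply, ← (summable_coeff_mul_eval hħ a z).tsum_add
      (summable_coeff_mul_eval hħ b z)]
    simp only [KoetheSpace.coeff_add, add_mul]
  map_smul' c a := by
    funext z
    rw [RingHom.id_apply, Pi.smul_apply, smul_eq_mul, ← tsum_mul_left]
    simp only [KoetheSpace.coeff_smul, mul_assoc]

theorem hasSum_koetheEval (a : KoetheSpace (Fin n ⊕ Fin n)) (z : Fin n → ℂ) :
    HasSum (fun N => a.coeff N * (wickBasis n hħ N).eval z) (koetheEval hħ a z) :=
  (summable_coeff_mul_eval hħ a z).hasSum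

theorem koetheEval_wickCoeff (f : WickAlgebra n hħ) (z : Fin n → ℂ) :
    koetheEval hħ (wickCoeff hħ f) z = f.eval z := by
  let E : WickAlgebra n hħ →ₗ[ℂ] ℂ :=
    (MvPolynomial.aeval (R := ℂ) (Sum.elim z fun k => starRingEnd ℂ (z k))).toLinearMap
  have hE : ∀ g, E g = WickAlgebra.eval g z := fun g => by
    change MvPolynomial.aeval _ _ = MvPolynomial.eval _ _
    rw [MvPolynomial.aeval_eq_eval]
  rw [← hE]
  conv_rhs => rw [← (wickBasis n hħ).linearCombination_repr f]
  rw [Finsupp.linearCombination_apply, Finsupp.sum, map_sum]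
  refine (tsum_eq_sum fun N hN => ?_).trans (Finset.sum_congr rfl fun N _ => ?_)
  · rw [coeff_wickCoeff, Finsupp.notMem_support_iff.1 hN, zero_mul]
  · rw [map_smul, hE, coeff_wickCoeff, smul_eq_mul]

theorem exists_hasFPowerSeriesOnBall_koetheEval (a : KoetheSpace (Fin n ⊕ Fin n)) :
    ∃ p : FormalMultilinearSeries ℝ (Fin n → ℂ) ℂ,
      HasFPowerSeriesOnBall (koetheEval hħ a) p 0 ⊤ ∧ ∀ k z, p k (fun _ => z) =
        ∑ N ∈ Finset.univ.finsuppAntidiag k,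
          a.coeff N * wickScale n ħ N * ∏ i, coordForm n i z ^ N i := by
  obtain ⟨p, hp, h⟩ := exists_hasFPowerSeriesOnBall (L := coordForm n) norm_coordForm_le
    (fun R hR => summable_coeff_mul_wickScale hħ a hR)
  refine ⟨p, ?_, h⟩
  convert hp using 1
  funext z
  change ∑' N, a.coeff N * (wickBasis n hħ N).eval z = _
  simp only [wickBasis_eval, mul_assoc]

theorem analyticOnNhd_koetheEval (a : KoetheSpace (Fin n ⊕ Fin n)) :
    AnalyticOnNhd ℝ (koetheEval hħ a) Set.univ := by
  obtain ⟨p, hp, -⟩ := exists_hasFPowerSeriesOnBall_koetheEval hħ a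
  simpa using hp.analyticOnNhd

/-- The power series of the zero function vanishes on the diagonal in each degree; each such
homogeneous part is a polynomial in z and z̄, whose coefficients must then be zero. -/
theorem injective_koetheEval : Function.Injective (koetheEval (n := n) hħ) := by
  rw [injective_iff_map_eq_zero]
  intro a ha
  obtain ⟨p, hp, h⟩ := exists_hasFPowerSeriesOnBall_koetheEval hħ a
  rw [ha] at hp
  ext N
  let P : MvPolynomial (Fin n ⊕ Fin n) ℂ := ∑ M ∈ Finset.univ.finsuppAntidiag N.degree,
    MvPolynomial.monomial M (a.coeff M * wickScale n ħ M)
  have hP : P = 0 := by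
    refine MvPolynomial.eq_zero_of_eval_conj_eq_zero fun z => ?_
    have h0 := hp.hasFPowerSeriesAt.apply_eq_zero N.degree z
    rw [h] at h0
    rw [← h0, map_sum]
    refine Finset.sum_congr rfl fun M _ => ?_
    rw [MvPolynomial.eval_monomial, Finsupp.prod_fintype _ _ fun _ => pow_zero _]
    simp only [coordForm_apply]
  have hc := congrArg (MvPolynomial.coeff N) hP
  simp only [P, MvPolynomial.coeff_sum, MvPolynomial.coeff_monomial, MvPolynomial.coeff_zero] at hc
  rw [Finset.sum_ite_eq', if_pos (mem_finsuppAntidiag_univ.2 rfl)] at hc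
  exact (mul_eq_zero.1 hc).resolve_right (isUnit_wickScale n hħ N).ne_zero

theorem KoetheSpace.hasSubfactorialGrowth {σ : Type*} (a : KoetheSpace σ) :
    HasSubfactorialGrowth a.coeff := by
  intro ε hε
  let ε' : Set.Ioo (0 : ℝ) 1 := ⟨min ε (1 / 2), by positivity,
    (min_le_right _ _).trans_lt (by norm_num)⟩
  refine ⟨koetheSeminorm σ ε' a, fun N => ?_⟩
  rw [mul_comm]
  refine (a.norm_coeff_le ε' N).trans ?_
  refine mul_le_mul_of_nonneg_right ?_ (apply_nonneg _ _)
  exact Real.rpow_le_rpow_of_exponent_le (by exact_mod_cast N.degree.factorial_pos)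
    (min_le_left _ _)

/-- Growth with exponent ε/2 leaves the summable weight $(|N|!)^{-\epsilon/2}$, so sup-type and
ℓ¹-type conditions describe the same families. -/
theorem HasSubfactorialGrowth.summable {σ : Type*} [Finite σ] {a : (σ →₀ ℕ) → ℂ}
    (ha : HasSubfactorialGrowth a) {ε : ℝ} (hε : 0 < ε) :
    Summable fun N => ‖a N‖ / (N.degree.factorial : ℝ) ^ ε := by
  obtain ⟨C, hC⟩ := ha (ε / 2) (by positivity)
  refine Summable.of_nonneg_of_le (fun N => by positivity) (fun N => ?_)
    ((summable_pow_mul_factorial_rpow (σ := σ) (c := 1) (δ := ε / 2) zero_le_one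
      (by positivity)).mul_left C)
  rw [div_le_iff₀ (by positivity), one_pow, one_mul, mul_assoc, ← Real.rpow_add (by positivity)]
  rw [show -(ε / 2) + ε = ε / 2 by ring]
  exact hC N

theorem range_koetheEval : Set.range (koetheEval (n := n) hħ) =
    {F | AnalyticOnNhd ℝ F Set.univ ∧ ∃ a : WickIndex n → ℂ, HasSubfactorialGrowth a ∧
      ∀ᶠ z in 𝓝 0, HasSum (fun N => a N * (wickBasis n hħ N).eval z) (F z)} := by
  ext F
  constructor
  · rintro ⟨a, rfl⟩
    exact ⟨analyticOnNhd_koetheEval hħ a, a.coeff, a.hasSubfactorialGrowth,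
      Eventually.of_forall fun z => hasSum_koetheEval hħ a z⟩
  · rintro ⟨hF, a, ha, hs⟩
    refine ⟨KoetheSpace.mk a fun ε hε => ha.summable hε.1, ?_⟩
    -- Agreement near 0 is enough by the identity theorem for analytic functions on the connected
    -- space ℂⁿ.
    refine (analyticOnNhd_koetheEval hħ _).eq_of_eventuallyEq hF (z₀ := 0) ?_
    filter_upwards [hs] with z hz
    exact (hasSum_koetheEval hħ _ z).unique hz

end Eval

end

theorem theorem3p2 (n : ℕ) (ħ : ℝ) (hħ : 0 < ħ) :
    -- the recursively defined seminorms are finite and are seminorms giving the topology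
    (∃ p : SeminormFamily ℂ (WickAlgebra n hħ) ((m : ℕ) × Fin (2 ^ m) × WickIndex n),
      (∀ m l γ f, ENNReal.ofReal (p ⟨m, l, γ⟩ f) =
        recNorm (wickBasis n hħ) (wickStar hħ) m l γ f) ∧
      WithSeminorms p) ∧
    -- a completion exists
    (∃ (E : Type) (_ : AddCommGroup E) (_ : Module ℂ E) (_ : UniformSpace E)
      (j : WickAlgebra n hħ →ₗ[ℂ] E), IsTVSCompletion j) ∧
    -- properties of the completion
    ∀ (E : Type*) [AddCommGroup E] [Module ℂ E] [UniformSpace E]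
      (j : WickAlgebra n hħ →ₗ[ℂ] E), IsTVSCompletion j →
      IsFrechetSpace E ∧
      -- the Wick star product extends to a continuous unital associative product
      (∃ mul : E →ₗ[ℂ] E →ₗ[ℂ] E,
        Continuous (fun x : E × E => mul x.1 x.2) ∧
        (∀ f g, mul (j f) (j g) = j (wickStar hħ f g)) ∧
        (∀ x y z, mul (mul x y) z = mul x (mul y z)) ∧
        (∀ x, mul (j (1 : MvPolynomial (Fin n ⊕ Fin n) ℂ)) x = x ∧
          mul x (j (1 : MvPolynomial (Fin n ⊕ Fin n) ℂ)) = x)) ∧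
      IsStronglyNuclear E ∧
      ∃ c : WickIndex n → E →L[ℂ] ℂ,
        IsAbsoluteSchauderBasis (fun N => j (wickBasis n hħ N)) c ∧
        -- the elements of the completion are functions on `ℂⁿ`: precisely the real-analytic
        -- ones whose Taylor coefficients with respect to the `e_{I,J}` grow sub-factorially
        (∃ ev : E →ₗ[ℂ] ((Fin n → ℂ) → ℂ),
          Function.Injective ev ∧
          (∀ f z, ev (j f) z = f.eval z) ∧
          (∀ x z, HasSum (fun N => c N x * (wickBasis n hħ N).eval z) (ev x z)) ∧
          Set.range ev = {F | AnalyticOnNhd ℝ F Set.univ ∧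
            ∃ a : WickIndex n → ℂ, HasSubfactorialGrowth a ∧
              ∀ᶠ z in 𝓝 0, HasSum (fun N => a N * (wickBasis n hħ N).eval z) (F z)}) ∧
        -- the coefficients give an isomorphism to the Köthe space of sub-factorial growth
        ∃ Φ : E ≃L[ℂ] KoetheSpace (Fin n ⊕ Fin n), ∀ x N, (Φ x).coeff N = c N x := by
  refine ⟨⟨wickSeminorm hħ, fun m l γ f => ofReal_wickSeminorm hħ m l γ f,
    withSeminorms_wickSeminorm hħ⟩, ⟨_, _, _, _, _, isTVSCompletion_wickCoeff hħ⟩, ?_⟩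
  intro E _ _ _ j hj
  have := (withSeminorms_wickSeminorm (n := n) hħ).topologicalAddGroup
  obtain ⟨Φ, hΦ⟩ := hj.exists_equiv (isTVSCompletion_wickCoeff hħ)
  refine ⟨hj.isFrechetSpace hħ, hj.exists_wick_mul hħ,
    KoetheSpace.isStronglyNuclear.of_equiv Φ,
    fun N => (KoetheSpace.coeffL N).comp (Φ : E →L[ℂ] _),
    KoetheSpace.isAbsoluteSchauderBasis.of_equiv Φ fun N => ?_,
    ⟨koetheEval hħ ∘ₗ Φ.toLinearEquiv.toLinearMap,
      (injective_koetheEval hħ).comp Φ.injective, fun f z => ?_,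
      fun x z => hasSum_koetheEval hħ (Φ x) z, ?_⟩, Φ, fun x N => rfl⟩
  · rw [hΦ, wickCoeff_wickBasis]
  · change koetheEval hħ (Φ (j f)) z = _
    rw [hΦ, koetheEval_wickCoeff]
  · rw [← range_koetheEval, LinearMap.coe_comp]
    exact Φ.surjective.range_comp _
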